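/- Let $A_1,\dots,A_n\subset\mathbb Z^n$ be finite, and assume that the mixed volume of $(\mathrm{conv}A_1,\dots,\mathrm{conv}A_n)$ is non-zero. Let $\mathscr V_{\mathbf A}\subset\mathbb P(\mathbb C^{A_1})\times\dots\times\mathbb P(\mathbb C^{A_n})$ be the Zariski closure of $\{([(\mathbf Z^{\mathbf a})_{\mathbf a\in A_1}],\dots,[(\mathbf Z^{\mathbf a})_{\mathbf a\in A_n}]):\mathbf Z\in(\mathbb C\setminus\{0\})^n\}$. For $\boldsymbol\xi\in\mathbb R^n$ let $A_i^{\boldsymbol\xi}$ be the set of $\mathbf a\in A_i$ with $\mathbf a\boldsymbol\xi=\sum_k a_k\xi_k$ maximal. For non-empty $B_i\subset A_i$ let $C(B_1,\dots,B_n)=\{\boldsymbol\xi: A_i^{\boldsymbol\xi}=B_i\ \forall i\}$. The outer fan of $\mathbf A$ is the set of closures of the non-empty $C(B_1,\dots,B_n)$; a ray is a one-dimensional cone of the fan, and an $n$-cone is a cone of the fan of dimension $n$. Let $\Lambda\subset\mathbb Z^n$ be the subgroup generated by all $\mathbf a-\mathbf a'$ with $\mathbf a,\mathbf a'\in A_i$,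 $1\le i\le n$, and $\Lambda^*=\{\mathbf x\in\mathbb R^n:\boldsymbol\lambda\mathbf x\in\mathbb Z\ \forall\boldsymbol\lambda\in\Lambda\}$. Then there is a finite family of maps $\Omega=([\Omega_{A_1}],\dots,[\Omega_{A_n}]):\mathbb C^l\times\mathbb C^{n-l}\to\mathbb P(\mathbb C^{A_1})\times\dots\times\mathbb P(\mathbb C^{A_n})$, $0\le l\le n$ ($l$ depending on $\Omega$), with coordinates $$\Omega_{i\mathbf a}(\mathbf X,\mathbf y)=\Bigl(\prod_{j=1}^{l}X_j^{(\mathbf a-\boldsymbol\theta_i)(-\boldsymbol\xi_j)}\Bigr)\,e^{(\mathbf a-\boldsymbol\theta_i)\sum_{j=l+1}^{n}(-\boldsymbol\xi_j)y_j}\qquad(\mathbf a\in A_i),$$ such that for each $\Omega$ in the family: 1. each $\boldsymbol\xi_j$ ($1\le j\le n$) is the minimal non-zero vector of $\Lambda^*$ on a ray of the outer fan; $\boldsymbol\xi_1,\dots,\boldsymbol\xi_n$ are linearly independent, and some $n$-cone of the outer fan contains all of them (and possibly more rays); 2. the shifts $\boldsymbol\theta_i\in\mathbb Z^n$ are such that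 all numbers $(\mathbf a-\boldsymbol\theta_i)(-\boldsymbol\xi_j)$, $\mathbf a\in A_i$, are non-negative integers, for each $i,j$ at least one of them is $0$ (so $\Omega_{A_i}$ is not a multiple of any $X_j$), and $\Omega_{A_i}(\mathbf X,\mathbf y)\neq 0$ for all $(\mathbf X,\mathbf y)$, in particular at $\mathbf X=0$; and such that, for all constants $\Phi>1$, $\Psi>0$, $\epsilon>0$, with $$\mathcal D_\Omega=\Bigl\{(\mathbf X,\mathbf y)\in\mathbb C^l\times\mathbb C^{n-l}:\ |X_1|,\dots,|X_l|<e^{-\Phi\|\Re(\mathbf y)\|_\infty-\Psi},\ -\tfrac{\Phi^{n-l}-1}{\Phi-1}\Psi-\epsilon<\Re(y_{l+1}),\dots,\Re(y_n)<\epsilon\Bigr\},$$ 3. each $\mathcal D_\Omega$ is open, and $\mathscr V_{\mathbf A}=\bigcup_\Omega\Omega(\mathcal D_\Omega)$; 4. for each $\Omega$ and each $(\mathbf X,\mathbf y)\in\mathcal D_\Omega$ such that the cone spanned by $\{\boldsymbol\xi_j: j\le l,\ X_j=0\}$ belongs to the outer fan, $\Omega(\mathcal D_\Omega)$ is a neighborhood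 of $\Omega(\mathbf X,\mathbf y)$ in $\mathscr V_{\mathbf A}$. In particular $\Omega(\mathcal D_\Omega)$ is open in $\mathscr V_{\mathbf A}$ if the cone spanned by $\boldsymbol\xi_1,\dots,\boldsymbol\xi_n$ belongs to the outer fan, for instance always if all $n$-cones of the fan are simplicial. The parameterizations $\Omega$ may be singular or many-to-one. -/

import Mathlib

open scoped Pointwise Topology LinearAlgebra.Projectivization

noncomputable section

namespace ToricChart

/-- The value `a ξ = ∑ k, a k * ξ k` of an integer covector `a` on a real vector `ξ`. -/
def pairing {n : ℕ} (a : Fin n → ℤ) (ξ : Fin n → ℝ) : ℝ :=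
  ∑ k, (a k : ℝ) * ξ k

/-! ### Mixed volume -/

/-- The convex hull in `ℝⁿ` of a finite set of integer points. -/
def polytope {n : ℕ} (S : Finset (Fin n → ℤ)) : Set (Fin n → ℝ) :=
  convexHull ℝ ((fun a : Fin n → ℤ => fun k => (a k : ℝ)) '' (S : Set (Fin n → ℤ)))

/-- The mixed volume of `(conv A₁, …, conv Aₙ)` by the polarization formula
`V = (1 / n!) ∑_{S ⊆ {1, …, n}} (-1)^(n - |S|) Vol (∑_{i ∈ S} conv Aᵢ)`, normalized so that
`V (K, …, K) = Vol K`; `n! V` is the coefficient of `t₁ ⋯ tₙ` in `Vol (∑ tᵢ conv Aᵢ)`. -/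
def mixedVolume {n : ℕ} (A : Fin n → Finset (Fin n → ℤ)) : ℝ :=
  (1 / (n.factorial : ℝ)) *
    ∑ S : Finset (Fin n), (-1 : ℝ) ^ (n - S.card) *
      (MeasureTheory.volume (∑ i ∈ S, polytope (A i))).toReal

/-! ### The outer fan and the dual lattice -/

/-- `Aᵢ^ξ`: the points of `S` at which the linear form `ξ` is maximal. -/
def faceOf {n : ℕ} (S : Finset (Fin n → ℤ)) (ξ : Fin n → ℝ) : Set (Fin n → ℤ) :=
  {a | a ∈ S ∧ ∀ b ∈ S, pairing b ξ ≤ pairing a ξ}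

/-- The outer cone `C(B₁, …, Bₙ)` of all `ξ` with `Aᵢ^ξ = Bᵢ` for every `i`. -/
def outerCone {n : ℕ} (A : Fin n → Finset (Fin n → ℤ)) (B : Fin n → Set (Fin n → ℤ)) :
    Set (Fin n → ℝ) :=
  {ξ | ∀ i, faceOf (A i) ξ = B i}

/-- `σ` belongs to the outer fan of `A`: it is the closure of some non-empty `C(B₁, …, Bₙ)`. -/
def IsFanCone {n : ℕ} (A : Fin n → Finset (Fin n → ℤ)) (σ : Set (Fin n → ℝ)) : Prop :=
  ∃ B : Fin n → Set (Fin n → ℤ),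
    (∀ i, (B i).Nonempty ∧ B i ⊆ (A i : Set (Fin n → ℤ))) ∧
      (outerCone A B).Nonempty ∧ σ = closure (outerCone A B)

/-- The dimension of a cone is the dimension of its linear span. -/
def coneDim {n : ℕ} (σ : Set (Fin n → ℝ)) : ℕ :=
  Module.finrank ℝ (Submodule.span ℝ σ)

/-- The `ℤ`-module `Λ` generated by all differences `a - a'` with `a, a' ∈ Aᵢ`, `1 ≤ i ≤ n`. -/
def latticeOf {n : ℕ} (A : Fin n → Finset (Fin n → ℤ)) : AddSubgroup (Fin n → ℤ) :=
  AddSubgroup.closure {u | ∃ i, ∃ a ∈ A i, ∃ a' ∈ A i, u = a - a'}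

/-- The dual `Λ*`: real vectors on which every element of `Λ` takes an integer value. -/
def dualLattice {n : ℕ} (A : Fin n → Finset (Fin n → ℤ)) : Set (Fin n → ℝ) :=
  {x | ∀ u ∈ latticeOf A, ∃ k : ℤ, pairing u x = k}

/-- `ξ` is the minimal non-zero vector of `Λ*` on a ray (one-dimensional cone) of the fan. -/
def IsMinimalRayGenerator {n : ℕ} (A : Fin n → Finset (Fin n → ℤ)) (ξ : Fin n → ℝ) : Prop :=
  ξ ∈ dualLattice A ∧
    (∃ ρ, IsFanCone A ρ ∧ coneDim ρ = 1 ∧ ρ = {x | ∃ t : ℝ, 0 ≤ t ∧ x = t • ξ}) ∧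
      ∀ t : ℝ, 0 < t → t • ξ ∈ dualLattice A → 1 ≤ t

/-! ### The toric variety -/

/-- The usual topology of a complex projective space: the quotient topology of the space of
non-zero vectors. -/
instance projTopology (ι : Type) : TopologicalSpace (ℙ ℂ (ι → ℂ)) :=
  inferInstanceAs (TopologicalSpace (Quotient (projectivizationSetoid ℂ (ι → ℂ))))

/-- The ambient space `ℙ(ℂ^{A₁}) × ⋯ × ℙ(ℂ^{Aₙ})`, with the product topology. -/
abbrev MultiProj {n : ℕ} (A : Fin n → Finset (Fin n → ℤ)) : Type :=
  ∀ i, ℙ ℂ (A i → ℂ)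

/-- The vector `V_S(Z) = (Z^a)_{a ∈ S}` of Laurent monomials at a point `Z` of the torus. -/
def veronese {n : ℕ} (S : Finset (Fin n → ℤ)) (Z : Fin n → ℂˣ) : S → ℂ :=
  fun a => ∏ k, ((Z k : ℂ) ^ (a.1 k))

/-- The image of the mixed Veronese (Kodaira) map `Z ↦ ([V_{A₁}(Z)], …, [V_{Aₙ}(Z)])`. -/
def torusImage {n : ℕ} (A : Fin n → Finset (Fin n → ℤ)) : Set (MultiProj A) :=
  {v | ∃ Z : Fin n → ℂˣ, ∀ i, ∃ h : veronese (A i) Z ≠ 0,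
    v i = Projectivization.mk ℂ (veronese (A i) Z) h}

/-- A polynomial in the coordinates of all factors vanishes at a point of the product. For
multihomogeneous polynomials this does not depend on the choice of representatives. -/
def VanishesAt {n : ℕ} {A : Fin n → Finset (Fin n → ℤ)} (F : MvPolynomial (Σ i, A i) ℂ)
    (v : MultiProj A) : Prop :=
  MvPolynomial.eval (fun s => (v s.1).rep s.2) F = 0

/-- Homogeneity of degree `d i` in the coordinates of the `i`-th factor, for every `i`. -/
def IsMultihomogeneous {n : ℕ} {A : Fin n → Finset (Fin n → ℤ)}
    (F : MvPolynomial (Σ i, A i) ℂ) (d : Fin n → ℕ) : Prop :=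
  MvPolynomial.IsWeightedHomogeneous
    (fun s : (Σ i, A i) => (Pi.single s.1 1 : Fin n → ℕ)) F d

/-- The Zariski closure in the product of projective spaces. -/
def zariskiClosure {n : ℕ} {A : Fin n → Finset (Fin n → ℤ)} (S : Set (MultiProj A)) :
    Set (MultiProj A) :=
  {v | ∀ (F : MvPolynomial (Σ i, A i) ℂ) (d : Fin n → ℕ), IsMultihomogeneous F d →
    (∀ u ∈ S, VanishesAt F u) → VanishesAt F v}

/-- The toric variety of the tuple `A`. -/
def toricVariety {n : ℕ} (A : Fin n → Finset (Fin n → ℤ)) : Set (MultiProj A) :=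
  zariskiClosure (torusImage A)

/-! ### Polynomial-exponential parameterizations -/

/-- The coordinate
`X^{(a - θ)(-ξ_j)} e^{(a - θ) ∑ (-ξ_j) y_j}` with `j ≤ l` in the product (index `Sum.inl j`) and
`j > l` in the exponential (index `Sum.inr j`). -/
def OmegaCoord {n l : ℕ} (ξ : Fin l ⊕ Fin (n - l) → Fin n → ℝ) (θ a : Fin n → ℤ)
    (p : (Fin l → ℂ) × (Fin (n - l) → ℂ)) : ℂ :=
  (∏ j, p.1 j ^ ((pairing (a - θ) (-ξ (Sum.inl j)) : ℝ) : ℂ)) *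
    Complex.exp (∑ j, ((pairing (a - θ) (-ξ (Sum.inr j)) : ℝ) : ℂ) * p.2 j)

/-- The vector `Ω_S(X, y) = (Ω_a(X, y))_{a ∈ S}`. -/
def OmegaVec {n l : ℕ} (ξ : Fin l ⊕ Fin (n - l) → Fin n → ℝ) (θ : Fin n → ℤ)
    (S : Finset (Fin n → ℤ)) (p : (Fin l → ℂ) × (Fin (n - l) → ℂ)) : S → ℂ :=
  fun a => OmegaCoord ξ θ a.1 p

/-- The data of a parameterization `Ω : ℂ^l × ℂ^{n-l} → ℙ(ℂ^{A₁}) × ⋯ × ℙ(ℂ^{Aₙ})`, together with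
the properties required of it. -/
structure Parameterization {n : ℕ} (A : Fin n → Finset (Fin n → ℤ)) where
  /-- the number of polynomial variables -/
  l : ℕ
  l_le : l ≤ n
  /-- `ξ₁, …, ξ_l` are the `ξ (Sum.inl j)`; `ξ_{l+1}, …, ξₙ` are the `ξ (Sum.inr j)` -/
  ξ : Fin l ⊕ Fin (n - l) → Fin n → ℝ
  /-- the shifts `θ₁, …, θₙ ∈ ℤⁿ` -/
  θ : Fin n → Fin n → ℤ
  minimal_ray : ∀ j, IsMinimalRayGenerator A (ξ j)
  linearIndependent : LinearIndependent ℝ ξ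
  /-- some `n`-dimensional cone of the fan contains all the `ξ_j` -/
  exists_cone : ∃ σ, IsFanCone A σ ∧ coneDim σ = n ∧ ∀ j, ξ j ∈ σ
  /-- all exponents are natural numbers, so that `Ω_{Aᵢ}` is defined at `X = 0` as well -/
  exponent_nat : ∀ i, ∀ a ∈ A i, ∀ j, ∃ k : ℕ, pairing (a - θ i) (-ξ j) = k
  /-- no `Ω_{Aᵢ}` is a multiple of an `X_j` -/
  exponent_zero : ∀ i j, ∃ a ∈ A i, pairing (a - θ i) (-ξ j) = 0
  /-- the point `[Ω_{Aᵢ}(X, y)]` is defined everywhere, in particular at `X = 0` -/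
  ne_zero : ∀ i p, OmegaVec ξ (θ i) (A i) p ≠ 0

namespace Parameterization

variable {n : ℕ} {A : Fin n → Finset (Fin n → ℤ)}

/-- The map `Ω (X, y) = ([Ω_{A₁}(X, y)], …, [Ω_{Aₙ}(X, y)])`. -/
def toFun (c : Parameterization A) (p : (Fin c.l → ℂ) × (Fin (n - c.l) → ℂ)) : MultiProj A :=
  fun i => Projectivization.mk ℂ (OmegaVec c.ξ (c.θ i) (A i) p) (c.ne_zero i p)

/-- The domain of `Ω`. The norm is the supremum norm (`0` on the zero-dimensional space). -/
def domain (c : Parameterization A) (Φ Ψ ε : ℝ) :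
    Set ((Fin c.l → ℂ) × (Fin (n - c.l) → ℂ)) :=
  {p | (∀ j, ‖p.1 j‖ < Real.exp (-Φ * ‖(fun k => (p.2 k).re : Fin (n - c.l) → ℝ)‖ - Ψ)) ∧
    ∀ j, -((Φ ^ (n - c.l) - 1) / (Φ - 1)) * Ψ - ε < (p.2 j).re ∧ (p.2 j).re < ε}

/-- The convex cone spanned by the `ξ_j` whose coordinate `X_j` vanishes at `p`; it is `{0}` if
there are none. -/
def vanishingCone (c : Parameterization A) (p : (Fin c.l → ℂ) × (Fin (n - c.l) → ℂ)) :
    Set (Fin n → ℝ) :=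
  {x | ∃ t : Fin c.l → ℝ, (∀ j, 0 ≤ t j ∧ (p.1 j ≠ 0 → t j = 0)) ∧
    x = ∑ j, t j • c.ξ (Sum.inl j)}

end Parameterization

end ToricChart

end

/-!
# Parameterizations of a toric variety by simplicial cones of its outer fan

A point of the toric variety `V_A` is described by a direction `η ∈ ℝⁿ` and a torus point `exp ζ`:
its coordinates `(i, a)` vanish unless `a` lies in the face of `A i` in direction `η`, and there they
are `exp (a ζ)` up to a factor depending on `i` only
(`exists_face_torus_of_mem_toricVariety`). This uses only the binomial equations of `V_A`. The
non-vanishing coordinates form a face by Farkas' lemma over `ℚ`, since otherwise a binomial equation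
has a vanishing and a non-vanishing side; they come from a torus point because `ℂˣ` is divisible, so
that homomorphisms of subgroups of a lattice to `ℂˣ` extend to the lattice. Such a point is the limit
of `exp (ζ + t η)` as `t → ∞`.

Peeling off rays one after the other writes every real vector as a non-negative combination of
linearly independent ray generators from one `n`-cone. Applied to `Re ζ + t η`, with a basis
that occurs for infinitely many `t` (there are finitely many rays), this gives a basis of rays in
which `η` has coordinates `β j ≥ 0` and `Re ζ` has coordinates `α j`, with `α j ≥ 0` wherever
`β j = 0` (`exists_basis_lex_decomposition`). In the parameterization with these rays the point has
`X j = 0` where `β j > 0`, and `|X j| = exp (-α j)` or `Re (y j) = -α j` elsewhere. Which rays become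
`y`-variables is decided by a gap in the sizes of the `α j` (`exists_gap`); the constants in the
domain are those of the gap. Hence the domains cover `V_A`; conversely their images lie in `V_A`,
because this is so where no `X j` vanishes, and by continuity elsewhere.

For the neighborhood property let `p` be a point whose vanishing rays span a cone `σ` of the fan. A
point of `V_A` near the image of `p` has at least the same non-vanishing coordinates, so that its
direction lies in `σ` and it is a value of the same parameterization. The domain only involves
`|X j|` and `Re (y j)`, which makes it unnecessary to control arguments, and these real
quantities depend continuously on the point of `V_A`: along the non-vanishing rays their logarithms
are linear in the logarithms of coordinates, because the span of `σ` is cut out by differences of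
points in its faces (`exists_linear_coord`), and along a vanishing ray a coordinate that sees no other
vanishing ray forces `|X j| → 0` (`exists_coordinate_of_vanishing`).
-/

namespace ToricChart

/-! ### The pairing and the faces it cuts out -/

section Faces

variable {n : ℕ}

theorem pairing_add (a : Fin n → ℤ) (x y : Fin n → ℝ) :
    pairing a (x + y) = pairing a x + pairing a y := by
  simp [pairing, mul_add, Finset.sum_add_distrib]

theorem pairing_smul (a : Fin n → ℤ) (t : ℝ) (x : Fin n → ℝ) :
    pairing a (t • x) = t * pairing a x := by
  simp only [pairing, Finset.mul_sum, Pi.smul_apply, smul_eq_mul]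
  exact Finset.sum_congr rfl fun k _ => by ring

theorem pairing_zero (a : Fin n → ℤ) : pairing a 0 = 0 := by simp [pairing]

theorem zero_pairing (x : Fin n → ℝ) : pairing 0 x = 0 := by simp [pairing]

theorem pairing_neg (a : Fin n → ℤ) (x : Fin n → ℝ) : pairing a (-x) = -pairing a x := by
  simp [pairing]

theorem pairing_sub_left (a b : Fin n → ℤ) (x : Fin n → ℝ) :
    pairing (a - b) x = pairing a x - pairing b x := by
  simp [pairing, sub_mul]

theorem pairing_sum_smul {ι : Type*} (s : Finset ι) (a : Fin n → ℤ) (t : ι → ℝ)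
    (ξ : ι → Fin n → ℝ) : pairing a (∑ j ∈ s, t j • ξ j) = ∑ j ∈ s, t j * pairing a (ξ j) := by
  classical
  induction s using Finset.induction_on with
  | empty => simp [pairing_zero]
  | insert j s hj ih =>
    rw [Finset.sum_insert hj, Finset.sum_insert hj, pairing_add, pairing_smul, ih]

theorem continuous_pairing (a : Fin n → ℤ) : Continuous (pairing a) := by
  unfold pairing; fun_prop

variable {S : Finset (Fin n → ℤ)} {x y : Fin n → ℝ} {a b : Fin n → ℤ}

theorem faceOf_nonempty (hS : S.Nonempty) (x : Fin n → ℝ) : (faceOf S x).Nonempty := by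
  obtain ⟨a, ha, h⟩ := S.exists_max_image (fun a => pairing a x) hS
  exact ⟨a, ha, h⟩

theorem pairing_eq_of_mem_faceOf (ha : a ∈ faceOf S x) (hb : b ∈ faceOf S x) :
    pairing a x = pairing b x :=
  le_antisymm (hb.2 a ha.1) (ha.2 b hb.1)

theorem mem_faceOf_iff (hb : b ∈ faceOf S x) :
    a ∈ faceOf S x ↔ a ∈ S ∧ pairing a x = pairing b x :=
  ⟨fun ha => ⟨ha.1, pairing_eq_of_mem_faceOf ha hb⟩, fun ha => ⟨ha.1, fun c hc => ha.2 ▸ hb.2 c hc⟩⟩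

theorem faceOf_smul {t : ℝ} (ht : 0 < t) (x : Fin n → ℝ) : faceOf S (t • x) = faceOf S x := by
  ext a
  simp only [faceOf, pairing_smul, Set.mem_ofPred_eq, mul_le_mul_iff_right₀ ht]

theorem faceOf_zero : faceOf S (0 : Fin n → ℝ) = S := by
  ext a
  simp [faceOf, pairing_zero]

theorem faceOf_add (hx : b ∈ faceOf S x) (hy : b ∈ faceOf S y) :
    faceOf S (x + y) = faceOf S x ∩ faceOf S y := by
  have hb : b ∈ faceOf S (x + y) := ⟨hx.1, fun c hc => by
    rw [pairing_add, pairing_add]; exact add_le_add (hx.2 c hc) (hy.2 c hc)⟩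
  ext a
  rw [Set.mem_inter_iff, mem_faceOf_iff hb, mem_faceOf_iff hx, mem_faceOf_iff hy, pairing_add,
    pairing_add]
  refine ⟨fun ⟨h1, h2⟩ => ?_, fun ⟨⟨h1, h2⟩, _, h3⟩ => ⟨h1, by rw [h2, h3]⟩⟩
  have := hx.2 a h1
  have := hy.2 a h1
  exact ⟨⟨h1, by linarith⟩, h1, by linarith⟩

/-- A point that is maximal for every `ξ j` is maximal for every non-negative combination. -/
theorem mem_faceOf_sum_smul {ι : Type*} (s : Finset ι) {t : ι → ℝ} {ξ : ι → Fin n → ℝ}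
    (ht : ∀ j ∈ s, 0 ≤ t j) (hb : b ∈ S) (h : ∀ j ∈ s, b ∈ faceOf S (ξ j)) :
    b ∈ faceOf S (∑ j ∈ s, t j • ξ j) := by
  refine ⟨hb, fun c hc => ?_⟩
  rw [pairing_sum_smul, pairing_sum_smul]
  exact Finset.sum_le_sum fun j hj => mul_le_mul_of_nonneg_left ((h j hj).2 c hc) (ht j hj)

end Faces

/-! ### The smallest fan cone containing a vector -/

section Fan

variable {n : ℕ}

/-- The set of all `y` whose faces contain those of `x`: the smallest cone of the outer fan that
contains `x`. -/
def carrierCone (A : Fin n → Finset (Fin n → ℤ)) (x : Fin n → ℝ) : Set (Fin n → ℝ) :=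
  {y | ∀ i, faceOf (A i) x ⊆ faceOf (A i) y}

/-- The subspace cut out by the differences of points in the faces of `x`: the linear span of
`carrierCone A x`. -/
def carrierSpan (A : Fin n → Finset (Fin n → ℤ)) (x : Fin n → ℝ) : Submodule ℝ (Fin n → ℝ) where
  carrier := {y | ∀ i, ∀ a ∈ faceOf (A i) x, ∀ b ∈ faceOf (A i) x, pairing a y = pairing b y}
  add_mem' := fun hy hz i a ha b hb => by
    rw [pairing_add, pairing_add, hy i a ha b hb, hz i a ha b hb]
  zero_mem' := fun i a _ b _ => by rw [pairing_zero, pairing_zero]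
  smul_mem' := fun t y hy i a ha b hb => by
    rw [pairing_smul, pairing_smul, hy i a ha b hb]

variable {A : Fin n → Finset (Fin n → ℤ)} {x y u : Fin n → ℝ}

theorem mem_carrierSpan : y ∈ carrierSpan A x ↔
    ∀ i, ∀ a ∈ faceOf (A i) x, ∀ b ∈ faceOf (A i) x, pairing a y = pairing b y := Iff.rfl

theorem self_mem_carrierCone : x ∈ carrierCone A x := fun _ => subset_rfl

theorem self_mem_carrierSpan : x ∈ carrierSpan A x :=
  fun _ _ ha _ hb => pairing_eq_of_mem_faceOf ha hb

theorem carrierCone_subset (h : y ∈ carrierCone A x) : carrierCone A y ⊆ carrierCone A x :=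
  fun _ hz i => (h i).trans (hz i)

theorem carrierSpan_le (h : y ∈ carrierCone A x) : carrierSpan A y ≤ carrierSpan A x :=
  fun _ hz i a ha b hb => hz i a (h i ha) b (h i hb)

theorem mem_carrierSpan_of_mem_carrierCone (h : y ∈ carrierCone A x) : y ∈ carrierSpan A x :=
  carrierSpan_le h self_mem_carrierSpan

theorem smul_mem_carrierCone {t : ℝ} (ht : 0 ≤ t) (hy : y ∈ carrierCone A x) :
    t • y ∈ carrierCone A x := by
  intro i
  rcases ht.eq_or_lt with rfl | ht
  · rw [zero_smul, faceOf_zero]; exact fun a ha => ha.1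
  · rw [faceOf_smul ht]; exact hy i

theorem isClosed_carrierCone : IsClosed (carrierCone A x) := by
  have : carrierCone A x = ⋂ i, ⋂ a ∈ faceOf (A i) x, ⋂ b ∈ A i,
      {y | pairing b y ≤ pairing a y} := by
    ext y
    simp only [carrierCone, Set.mem_ofPred_eq, Set.mem_iInter]
    exact ⟨fun h i a ha b hb => (h i ha).2 b hb, fun h i a ha => ⟨ha.1, h i a ha⟩⟩
  rw [this]
  exact isClosed_iInter fun i => isClosed_iInter fun a => isClosed_iInter fun _ =>
    isClosed_iInter fun b => isClosed_iInter fun _ =>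
      isClosed_le (continuous_pairing b) (continuous_pairing a)

theorem closure_outerCone (hA : ∀ i, (A i).Nonempty) (x : Fin n → ℝ) :
    closure (outerCone A fun i => faceOf (A i) x) = carrierCone A x := by
  refine subset_antisymm (closure_minimal (fun y hy i => (hy i).ge) isClosed_carrierCone) ?_
  intro y hy
  -- `y` is the limit of `y + t x`, which has the faces of `x` for `t > 0`
  have hlim : Filter.Tendsto (fun t : ℝ => y + t • x) (𝓝[>] 0) (𝓝 y) := by
    have : Continuous fun t : ℝ => y + t • x := by fun_prop
    simpa using (this.tendsto 0).mono_left nhdsWithin_le_nhds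
  refine mem_closure_of_tendsto hlim ?_
  filter_upwards [self_mem_nhdsWithin] with t ht i
  obtain ⟨b, hb⟩ := faceOf_nonempty (hA i) x
  have h := faceOf_smul (S := A i) ht x
  rw [faceOf_add (hy i hb) (h ▸ hb), h]
  exact Set.inter_eq_right.mpr (hy i)

theorem isFanCone_iff (hA : ∀ i, (A i).Nonempty) {σ : Set (Fin n → ℝ)} :
    IsFanCone A σ ↔ ∃ x, σ = carrierCone A x := by
  constructor
  · rintro ⟨B, -, ⟨x, hx⟩, rfl⟩
    refine ⟨x, ?_⟩
    rw [← closure_outerCone hA, show B = fun i => faceOf (A i) x from funext fun i => (hx i).symm]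
  · rintro ⟨x, rfl⟩
    exact ⟨fun i => faceOf (A i) x, fun i => ⟨faceOf_nonempty (hA i) x, fun a ha => ha.1⟩,
      ⟨x, fun i => rfl⟩, (closure_outerCone hA x).symm⟩

/-- Faces can only shrink under a small perturbation. -/
theorem eventually_faceOf_subset (x y : Fin n → ℝ) :
    ∀ᶠ ε in 𝓝[>] (0 : ℝ), ∀ i, faceOf (A i) (x + ε • y) ⊆ faceOf (A i) x := by
  have key : ∀ i, ∀ a ∈ A i, ∀ᶠ ε in 𝓝[>] (0 : ℝ),
      a ∈ faceOf (A i) (x + ε • y) → a ∈ faceOf (A i) x := by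
    intro i a ha
    by_cases hax : a ∈ faceOf (A i) x
    · exact Filter.Eventually.of_forall fun _ _ => hax
    · have : ∃ b ∈ A i, pairing a x < pairing b x := by
        by_contra! h
        exact hax ⟨ha, h⟩
      obtain ⟨b, hb, hlt⟩ := this
      have hc : ∀ c : Fin n → ℤ,
          Filter.Tendsto (fun ε : ℝ => pairing c (x + ε • y)) (𝓝[>] 0) (𝓝 (pairing c x)) := by
        intro c
        have : Continuous fun ε : ℝ => pairing c (x + ε • y) :=
          (continuous_pairing c).comp (by fun_prop)
        simpa using (this.tendsto 0).mono_left nhdsWithin_le_nhds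
      filter_upwards [(hc a).eventually_lt (hc b) hlt] with ε h hmem
      exact absurd (hmem.2 b hb) (not_le.mpr h)
  have key2 : ∀ i, ∀ᶠ ε in 𝓝[>] (0 : ℝ), ∀ a ∈ A i,
      a ∈ faceOf (A i) (x + ε • y) → a ∈ faceOf (A i) x := fun i =>
    (Filter.eventually_all_finset (A i)).mpr (key i)
  filter_upwards [Filter.eventually_all.mpr key2] with ε h i a ha using h i a ha.1 ha

/-- The set of vectors with the same faces as `x` is open in `carrierSpan A x`. -/
theorem eventually_faceOf_eq (hA : ∀ i, (A i).Nonempty) (hy : y ∈ carrierSpan A x) :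
    ∀ᶠ ε in 𝓝[>] (0 : ℝ), ∀ i, faceOf (A i) (x + ε • y) = faceOf (A i) x := by
  filter_upwards [eventually_faceOf_subset (A := A) x y] with ε h i
  refine (h i).antisymm fun a ha => ?_
  obtain ⟨c, hc⟩ := faceOf_nonempty (hA i) (x + ε • y)
  rw [mem_faceOf_iff hc, pairing_add, pairing_add, pairing_smul, pairing_smul,
    hy i a ha c (h i hc), pairing_eq_of_mem_faceOf ha (h i hc)]
  exact ⟨ha.1, rfl⟩

theorem exists_add_smul_mem_carrierCone (hA : ∀ i, (A i).Nonempty) (hy : y ∈ carrierSpan A x) :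
    ∃ ε : ℝ, 0 < ε ∧ x + ε • y ∈ carrierCone A x := by
  obtain ⟨ε, h, hε⟩ := ((eventually_faceOf_eq hA hy).and self_mem_nhdsWithin).exists
  exact ⟨ε, hε, fun i => (h i).ge⟩

/-- Moving from `x` in a direction `u` of its span that is somewhere increasing, one reaches the
relative boundary of the smallest cone containing `x`. -/
theorem exists_exit (hA : ∀ i, (A i).Nonempty) (hu : u ∈ carrierSpan A x)
    (h : ∃ i, ∃ a ∈ A i, ∃ b ∈ faceOf (A i) x, pairing b u < pairing a u) :
    ∃ t : ℝ, 0 < t ∧ x + t • u ∈ carrierCone A x ∧ x ∉ carrierSpan A (x + t • u) := by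
  classical
  choose b hb using fun i => faceOf_nonempty (hA i) x
  let f : (Σ i, A i) → ℝ := fun s =>
    (pairing (b s.1) x - pairing s.2.1 x) / (pairing s.2.1 u - pairing (b s.1) u)
  let Q : Finset (Σ i, A i) :=
    Finset.univ.filter fun s => pairing (b s.1) u < pairing s.2.1 u
  have hQ : Q.Nonempty := by
    obtain ⟨i, a, ha, c, hc, hlt⟩ := h
    exact ⟨⟨i, a, ha⟩, by simpa [Q, hu i (b i) (hb i) c hc] using hlt⟩
  obtain ⟨s, hs, hmin⟩ := Q.exists_min_image f hQ
  have hpos : ∀ s ∈ Q, 0 < pairing s.2.1 u - pairing (b s.1) u := fun s hs => by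
    have := (Finset.mem_filter.mp hs).2
    linarith
  have hlt : pairing s.2.1 x < pairing (b s.1) x := by
    refine lt_of_le_of_ne ((hb s.1).2 _ s.2.2) fun heq => ?_
    have hmem : s.2.1 ∈ faceOf (A s.1) x := (mem_faceOf_iff (hb s.1)).mpr ⟨s.2.2, heq⟩
    have := hpos s hs
    rw [hu s.1 _ hmem _ (hb s.1)] at this
    linarith
  have ht : 0 < f s := div_pos (by linarith) (hpos s hs)
  have hbt : ∀ i, b i ∈ faceOf (A i) (x + f s • u) := by
    refine fun i => ⟨(hb i).1, fun a ha => ?_⟩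
    simp only [pairing_add, pairing_smul]
    have h1 := (hb i).2 a ha
    by_cases hq : (⟨i, a, ha⟩ : Σ i, A i) ∈ Q
    · have h2 := hmin _ hq
      have h3 := hpos _ hq
      have h4 := (le_div_iff₀ h3).mp h2
      simp only at h4
      linarith
    · have h2 : pairing a u ≤ pairing (b i) u := by simpa [Q] using hq
      nlinarith
  refine ⟨f s, ht, fun i a ha => ?_, fun hx => ?_⟩
  · rw [mem_faceOf_iff (hbt i)]
    simp only [pairing_add, pairing_smul]
    rw [hu i a ha _ (hb i), pairing_eq_of_mem_faceOf ha (hb i)]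
    exact ⟨ha.1, rfl⟩
  · have hmem : s.2.1 ∈ faceOf (A s.1) (x + f s • u) := by
      rw [mem_faceOf_iff (hbt s.1)]
      simp only [pairing_add, pairing_smul]
      have := (div_mul_cancel₀ (pairing (b s.1) x - pairing s.2.1 x) (hpos s hs).ne' : f s * _ = _)
      exact ⟨s.2.2, by linarith⟩
    have := hx s.1 _ hmem _ (hbt s.1)
    linarith

end Fan

/-! ### Rays of the outer fan -/

section Rays

variable {n : ℕ}

/-- Integral linear equations with a non-zero real solution have a non-zero integral solution. -/
theorem exists_int_ne_zero_of_real (D : Set (Fin n → ℤ)) {x : Fin n → ℝ} (hx : x ≠ 0)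
    (h : ∀ d ∈ D, pairing d x = 0) :
    ∃ q : Fin n → ℤ, q ≠ 0 ∧ ∀ d ∈ D, pairing d (fun k => (q k : ℝ)) = 0 := by
  let W : Submodule ℚ (Fin n → ℚ) := Submodule.span ℚ ((fun d k => (d k : ℚ)) '' D)
  have hWx : ∀ v ∈ W, ∑ k, (v k : ℝ) * x k = 0 := by
    intro v hv
    induction hv using Submodule.span_induction with
    | mem v hv =>
      obtain ⟨d, hd, rfl⟩ := hv
      simpa [pairing] using h d hd
    | zero => simp
    | add v w _ _ hv hw => simp [add_mul, Finset.sum_add_distrib, hv, hw]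
    | smul t v _ hv =>
      have : ∑ k, ((t • v) k : ℝ) * x k = t * ∑ k, (v k : ℝ) * x k := by
        rw [Finset.mul_sum]
        exact Finset.sum_congr rfl fun k _ => by simp [mul_assoc]
      rw [this, hv, mul_zero]
  have hW : W < ⊤ := by
    refine lt_top_iff_ne_top.mpr fun htop => hx ?_
    ext k
    have := hWx (Pi.single k 1) (htop ▸ Submodule.mem_top)
    rw [Finset.sum_eq_single k (fun j _ hj => by simp [hj]) (by simp)] at this
    simpa using this
  obtain ⟨f, hf, hle⟩ := Submodule.exists_le_ker_of_lt_top W hW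
  obtain ⟨N, hN⟩ := IsLocalization.exist_integer_multiples_of_finite (nonZeroDivisors ℤ)
    (fun k : Fin n => f (Pi.single k 1))
  choose q hq using hN
  have hq' : ∀ k, (q k : ℚ) = (N : ℤ) * f (Pi.single k 1) := fun k => by
    have := hq k
    simpa [Algebra.smul_def] using this
  have hN0 : ((N : ℤ) : ℚ) ≠ 0 := by exact_mod_cast nonZeroDivisors.ne_zero N.2
  have hfv : ∀ v : Fin n → ℚ, f v = ∑ k, v k * f (Pi.single k 1) := fun v => by
    conv_lhs => rw [pi_eq_sum_univ' v]
    simp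
  refine ⟨q, fun h0 => hf ?_, fun d hd => ?_⟩
  · ext k
    have := hq' k
    rw [h0] at this
    simpa [hN0] using this.symm
  · have h1 : f (fun k => (d k : ℚ)) = 0 := hle (Submodule.subset_span ⟨d, hd, rfl⟩)
    rw [hfv] at h1
    have h2 : ∑ k, (d k : ℚ) * (q k : ℚ) = 0 := by
      calc ∑ k, (d k : ℚ) * (q k : ℚ) = (N : ℤ) * ∑ k, (d k : ℚ) * f (Pi.single k 1) := by
            rw [Finset.mul_sum]
            exact Finset.sum_congr rfl fun k _ => by rw [hq']; ring
        _ = 0 := by rw [h1, mul_zero]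
    have h3 : ∑ k, d k * q k = 0 := by exact_mod_cast h2
    simp only [pairing]
    exact_mod_cast h3

/-- Only the zero form is constant on every `A i`. Equivalently, `Λ` has full rank, or the cones of
the outer fan are pointed. -/
def IsNondegenerate (A : Fin n → Finset (Fin n → ℤ)) : Prop :=
  ∀ x : Fin n → ℝ, (∀ i, ∀ a ∈ A i, ∀ b ∈ A i, pairing a x = pairing b x) → x = 0

variable {A : Fin n → Finset (Fin n → ℤ)} {x y : Fin n → ℝ}

theorem sub_mem_latticeOf {i : Fin n} {a b : Fin n → ℤ} (ha : a ∈ A i) (hb : b ∈ A i) :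
    a - b ∈ latticeOf A :=
  AddSubgroup.subset_closure ⟨i, a, ha, b, hb, rfl⟩

/-- The cones of the outer fan are pointed. -/
theorem eq_zero_of_neg_mem_carrierCone (hA : ∀ i, (A i).Nonempty) (hnd : IsNondegenerate A)
    (h : -x ∈ carrierCone A x) : x = 0 := by
  refine hnd x fun i => ?_
  obtain ⟨c, hc⟩ := faceOf_nonempty (hA i) x
  have key : ∀ a ∈ A i, pairing a x = pairing c x := fun a ha => by
    have h1 := hc.2 a ha
    have h2 := (h i hc).2 a ha
    rw [pairing_neg, pairing_neg] at h2
    linarith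
  intro a ha b hb
  rw [key a ha, key b hb]

/-- On a line spanned by a vector with rational direction there is a shortest positive multiple in
the dual lattice. -/
theorem exists_minimal_smul_mem_dualLattice (hnd : IsNondegenerate A) (hx : x ≠ 0)
    (h : ∃ t : ℝ, 0 < t ∧ t • x ∈ dualLattice A) :
    ∃ t : ℝ, 0 < t ∧ t • x ∈ dualLattice A ∧
      ∀ s : ℝ, 0 < s → s • t • x ∈ dualLattice A → 1 ≤ s := by
  have : ∃ u ∈ latticeOf A, pairing u x ≠ 0 := by
    by_contra! h0
    refine hx (hnd x fun i a ha b hb => ?_)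
    have := h0 _ (sub_mem_latticeOf ha hb)
    rw [pairing_sub_left] at this
    linarith
  obtain ⟨u, hu, hux⟩ := this
  -- positive multiples of `x` in the dual lattice are ordered by the natural number `|u (t x)|`
  have hex : ∃ m : ℕ, ∃ t : ℝ, 0 < t ∧ t • x ∈ dualLattice A ∧ |pairing u (t • x)| = m := by
    obtain ⟨t, ht, hmem⟩ := h
    obtain ⟨k, hk⟩ := hmem u hu
    exact ⟨k.natAbs, t, ht, hmem, by rw [hk, Nat.cast_natAbs, Int.cast_abs]⟩
  classical
  obtain ⟨t, ht, hmem, hm⟩ := Nat.find_spec hex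
  refine ⟨t, ht, hmem, fun s hs hsmem => ?_⟩
  obtain ⟨k, hk⟩ := hsmem u hu
  have hle := Nat.find_min' hex ⟨s * t, mul_pos hs ht, by rwa [mul_smul],
    (show |pairing u ((s * t) • x)| = (k.natAbs : ℝ) by
      rw [mul_smul, hk, Nat.cast_natAbs, Int.cast_abs])⟩
  have hpos : 0 < |pairing u (t • x)| := by
    rw [pairing_smul]
    exact abs_pos.mpr (mul_ne_zero ht.ne' hux)
  have h1 : |pairing u (t • x)| ≤ s * |pairing u (t • x)| := by
    have : s * |pairing u (t • x)| = |pairing u (s • t • x)| := by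
      rw [pairing_smul u s, abs_mul, abs_of_pos hs]
    rw [this, hm, hk]
    have : |(k : ℝ)| = (k.natAbs : ℝ) := by rw [Nat.cast_natAbs, Int.cast_abs]
    rw [this]
    exact_mod_cast hle
  exact (le_mul_iff_one_le_left hpos).mp h1

/-- If the span of the smallest cone containing `x` is the line through `x`, then this cone is a
ray of the fan and has a minimal generator. -/
theorem exists_isMinimalRayGenerator_smul (hA : ∀ i, (A i).Nonempty) (hnd : IsNondegenerate A)
    (hx : x ≠ 0) (h : carrierSpan A x ≤ Submodule.span ℝ {x}) :
    ∃ t : ℝ, 0 < t ∧ IsMinimalRayGenerator A (t • x) := by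
  -- the line is rational, so that it meets the dual lattice
  have hrat : ∃ t : ℝ, 0 < t ∧ t • x ∈ dualLattice A := by
    obtain ⟨q, hq0, hq⟩ := exists_int_ne_zero_of_real
      {d | ∃ i, ∃ a ∈ faceOf (A i) x, ∃ b ∈ faceOf (A i) x, d = a - b} hx (by
        rintro _ ⟨i, a, ha, b, hb, rfl⟩
        rw [pairing_sub_left, pairing_eq_of_mem_faceOf ha hb, sub_self])
    have hmem : (fun k => (q k : ℝ)) ∈ carrierSpan A x := fun i a ha b hb => by
      have := hq _ ⟨i, a, ha, b, hb, rfl⟩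
      rw [pairing_sub_left] at this
      linarith
    obtain ⟨s, hs⟩ := Submodule.mem_span_singleton.mp (h hmem)
    have hs0 : s ≠ 0 := by
      rintro rfl
      apply hq0
      ext k
      have := congrFun hs k
      simpa using this.symm
    refine ⟨|s|, abs_pos.mpr hs0, fun u _ => ?_⟩
    have hint : pairing u (s • x) = ((∑ k, u k * q k : ℤ) : ℝ) := by
      rw [hs]; simp [pairing]
    rcases abs_choice s with h1 | h1 <;> rw [h1]
    · exact ⟨_, hint⟩
    · exact ⟨-∑ k, u k * q k, by rw [neg_smul, pairing_neg, hint, Int.cast_neg]⟩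
  obtain ⟨t, ht, hmem, hmin⟩ := exists_minimal_smul_mem_dualLattice hnd hx hrat
  have hcone : carrierCone A x = {y | ∃ s : ℝ, 0 ≤ s ∧ y = s • t • x} := by
    ext y
    constructor
    · intro hy
      obtain ⟨s, rfl⟩ := Submodule.mem_span_singleton.mp
        (h (mem_carrierSpan_of_mem_carrierCone hy))
      rcases le_or_gt 0 s with hs | hs
      · exact ⟨s / t, div_nonneg hs ht.le, by rw [smul_smul, div_mul_cancel₀ _ ht.ne']⟩
      · refine absurd (eq_zero_of_neg_mem_carrierCone hA hnd ?_) hx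
        have := smul_mem_carrierCone (t := (-s)⁻¹) (by simpa using hs.le) hy
        rwa [smul_smul, inv_neg, neg_mul, inv_mul_cancel₀ hs.ne, neg_one_smul] at this
    · rintro ⟨s, hs, rfl⟩
      exact smul_mem_carrierCone hs (smul_mem_carrierCone ht.le self_mem_carrierCone)
  refine ⟨t, ht, hmem, ⟨carrierCone A x, (isFanCone_iff hA).mpr ⟨x, rfl⟩, ?_, hcone⟩, hmin⟩
  have hspan : Submodule.span ℝ (carrierCone A x) = Submodule.span ℝ {x} :=
    le_antisymm (Submodule.span_le.mpr fun y hy => h (mem_carrierSpan_of_mem_carrierCone hy))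
      (Submodule.span_mono (by simpa using self_mem_carrierCone))
  rw [coneDim, hspan, finrank_span_singleton hx]

/-- Every non-zero cone of the fan contains a ray of the fan. -/
theorem exists_ray_mem_carrierCone (hA : ∀ i, (A i).Nonempty) (hnd : IsNondegenerate A)
    (hx : x ≠ 0) : ∃ ρ ∈ carrierCone A x, IsMinimalRayGenerator A ρ := by
  induction hd : Module.finrank ℝ (carrierSpan A x) using Nat.strong_induction_on generalizing x with
  | _ d ih =>
    subst hd
    by_cases hline : carrierSpan A x ≤ Submodule.span ℝ {x}
    · obtain ⟨t, ht, h⟩ := exists_isMinimalRayGenerator_smul hA hnd hx hline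
      exact ⟨t • x, smul_mem_carrierCone ht.le self_mem_carrierCone, h⟩
    · obtain ⟨u, hu, hux⟩ := SetLike.not_le_iff_exists.mp hline
      -- one of the directions `u`, `-u` leads out of the cone
      have : ∃ u ∈ carrierSpan A x, u ∉ Submodule.span ℝ {x} ∧
          ∃ i, ∃ a ∈ A i, ∃ b ∈ faceOf (A i) x, pairing b u < pairing a u := by
        by_contra! hcon
        have h1 := hcon u hu hux
        have h2 := hcon (-u) (neg_mem hu) (by rwa [neg_mem_iff])
        have hu0 : u = 0 := by
          refine hnd u fun i => ?_
          obtain ⟨c, hc⟩ := faceOf_nonempty (hA i) x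
          have key : ∀ a ∈ A i, pairing a u = pairing c u := fun a ha => by
            have h3 := h1 i a ha c hc
            have h4 := h2 i a ha c hc
            rw [pairing_neg, pairing_neg] at h4
            linarith
          intro a ha b hb
          rw [key a ha, key b hb]
        exact hux (hu0 ▸ zero_mem _)
      obtain ⟨u, hu, hux, hinc⟩ := this
      obtain ⟨t, ht, hmem, hnot⟩ := exists_exit hA hu hinc
      have hne : x + t • u ≠ 0 := by
        intro h0
        apply hux
        have : u = (-t⁻¹) • x := by
          rw [eq_neg_of_add_eq_zero_left h0, smul_neg, neg_smul, neg_neg, smul_smul,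
            inv_mul_cancel₀ ht.ne', one_smul]
        rw [this]
        exact Submodule.smul_mem _ _ (Submodule.mem_span_singleton_self x)
      have hlt : carrierSpan A (x + t • u) < carrierSpan A x :=
        lt_of_le_of_ne (carrierSpan_le hmem) fun h => hnot (h ▸ self_mem_carrierSpan)
      obtain ⟨ρ, hρ, hmin⟩ := ih _ (Submodule.finrank_lt_finrank_of_lt hlt) hne rfl
      exact ⟨ρ, carrierCone_subset hmem hρ, hmin⟩

theorem IsMinimalRayGenerator.ne_zero (hρ : IsMinimalRayGenerator A x) : x ≠ 0 := by
  rintro rfl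
  have := hρ.2.2 (1 / 2) (by norm_num) (by simpa using hρ.1)
  norm_num at this

/-- A vector is a non-negative combination of linearly independent ray generators of the smallest
cone containing it: subtract a multiple of a ray generator until the boundary of the cone is
reached, and repeat. -/
theorem exists_simplicial_decomposition (hA : ∀ i, (A i).Nonempty) (hnd : IsNondegenerate A)
    (x : Fin n → ℝ) :
    ∃ T : Finset (Fin n → ℝ), LinearIndepOn ℝ id (T : Set (Fin n → ℝ)) ∧
      (∀ ρ ∈ T, ρ ∈ carrierCone A x ∧ IsMinimalRayGenerator A ρ) ∧
      ∃ c : (Fin n → ℝ) → ℝ, (∀ ρ, 0 ≤ c ρ) ∧ x = ∑ ρ ∈ T, c ρ • ρ := by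
  classical
  induction hd : Module.finrank ℝ (carrierSpan A x) using Nat.strong_induction_on generalizing x with
  | _ d ih =>
    subst hd
    by_cases hx : x = 0
    · exact ⟨∅, by simp, by simp, 0, by simp, by simp [hx]⟩
    obtain ⟨ρ, hρ, hmin⟩ := exists_ray_mem_carrierCone hA hnd hx
    have hρ0 := hmin.ne_zero
    have hinc : ∃ i, ∃ a ∈ A i, ∃ b ∈ faceOf (A i) x, pairing b (-ρ) < pairing a (-ρ) := by
      by_contra! hcon
      refine hρ0 (eq_zero_of_neg_mem_carrierCone hA hnd fun i a ha => ?_)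
      obtain ⟨c, hc⟩ := faceOf_nonempty (hA i) x
      have h1 := (mem_faceOf_iff (hρ i hc)).mp ha
      refine ⟨h1.1, fun b hb => ?_⟩
      have := hcon i b hb c hc
      rw [pairing_neg] at this ⊢
      rw [pairing_neg] at this ⊢
      linarith
    obtain ⟨t, ht, hmem, hnot⟩ :=
      exists_exit hA (neg_mem (mem_carrierSpan_of_mem_carrierCone hρ)) hinc
    have hlt : carrierSpan A (x + t • -ρ) < carrierSpan A x :=
      lt_of_le_of_ne (carrierSpan_le hmem) fun h => hnot (h ▸ self_mem_carrierSpan)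
    obtain ⟨T, hT, hTρ, c, hc, hsum⟩ := ih _ (Submodule.finrank_lt_finrank_of_lt hlt) _ rfl
    have hspan : Submodule.span ℝ (T : Set (Fin n → ℝ)) ≤ carrierSpan A (x + t • -ρ) :=
      Submodule.span_le.mpr fun v hv => mem_carrierSpan_of_mem_carrierCone (hTρ v hv).1
    have hρT : ρ ∉ Submodule.span ℝ (T : Set (Fin n → ℝ)) := by
      intro h
      apply hnot
      have h1 := add_mem self_mem_carrierSpan (Submodule.smul_mem _ t (hspan h))
      simpa using h1
    have hρT' : ρ ∉ T := fun h => hρT (Submodule.subset_span h)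
    refine ⟨insert ρ T, ?_, ?_, Function.update c ρ t, ?_, ?_⟩
    · rw [Finset.coe_insert]
      exact (linearIndepOn_id_insert (by simpa using hρT')).mpr ⟨hT, hρT⟩
    · intro v hv
      rcases Finset.mem_insert.mp hv with rfl | hv
      · exact ⟨hρ, hmin⟩
      · exact ⟨carrierCone_subset hmem (hTρ v hv).1, (hTρ v hv).2⟩
    · intro v
      by_cases hv : v = ρ
      · subst hv; simpa using ht.le
      · simpa [hv] using hc v
    · rw [Finset.sum_insert hρT', Function.update_self,
        Finset.sum_congr rfl (g := fun v => c v • v) fun v hv => by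
          rw [Function.update_of_ne (ne_of_mem_of_not_mem hv hρT')], ← hsum]
      simp

/-- Every vector lies in a cone of the fan all of whose faces are points. -/
theorem exists_generic (A : Fin n → Finset (Fin n → ℤ)) (x : Fin n → ℝ) :
    ∃ w, x ∈ carrierCone A w ∧ carrierSpan A w = ⊤ := by
  by_contra! hcon
  -- a perturbation off `carrierSpan A w` enlarges it
  have step : ∀ w, x ∈ carrierCone A w → ∃ w', x ∈ carrierCone A w' ∧
      carrierSpan A w < carrierSpan A w' := by
    intro w hw
    obtain ⟨y, -, hy⟩ := SetLike.exists_of_lt (lt_top_iff_ne_top.mpr (hcon w hw))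
    obtain ⟨ε, hsub, hε⟩ :=
      ((eventually_faceOf_subset (A := A) w y).and self_mem_nhdsWithin).exists
    have hle : carrierSpan A w ≤ carrierSpan A (w + ε • y) :=
      fun z hz i a ha b hb => hz i a (hsub i ha) b (hsub i hb)
    refine ⟨w + ε • y, fun i => (hsub i).trans (hw i), lt_of_le_of_ne hle fun h => hy ?_⟩
    have h1 : w + ε • y ∈ carrierSpan A w := h ▸ self_mem_carrierSpan
    have h2 := (Submodule.add_mem_iff_right _ self_mem_carrierSpan).mp h1
    exact (Submodule.smul_mem_iff _ (ne_of_gt hε)).mp h2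
  have grow : ∀ d : ℕ, ∃ w, x ∈ carrierCone A w ∧ d ≤ Module.finrank ℝ (carrierSpan A w) := by
    intro d
    induction d with
    | zero => exact ⟨x, self_mem_carrierCone, Nat.zero_le _⟩
    | succ d ih =>
      obtain ⟨w, hw, hd⟩ := ih
      obtain ⟨w', hw', hlt⟩ := step w hw
      exact ⟨w', hw', hd.trans_lt (Submodule.finrank_lt_finrank_of_lt hlt)⟩
  obtain ⟨w, -, hw⟩ := grow (n + 1)
  have := hw.trans (Submodule.finrank_le _)
  simp at this

/-- Every vector is a non-negative combination of a basis of ray generators that lie in a common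
`n`-dimensional cone. -/
theorem exists_basis_decomposition (hA : ∀ i, (A i).Nonempty) (hnd : IsNondegenerate A)
    (x : Fin n → ℝ) :
    ∃ ξ : Fin n → Fin n → ℝ, LinearIndependent ℝ ξ ∧ (∀ j, IsMinimalRayGenerator A (ξ j)) ∧
      (∃ w, ∀ j, ξ j ∈ carrierCone A w) ∧
      ∃ c : Fin n → ℝ, (∀ j, 0 ≤ c j) ∧ x = ∑ j, c j • ξ j := by
  classical
  obtain ⟨w, hxw, hw⟩ := exists_generic A x
  let R : Set (Fin n → ℝ) := {ρ | ρ ∈ carrierCone A w ∧ IsMinimalRayGenerator A ρ}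
  -- vectors near `w` have the same faces, so that the rays of the cone span
  have hmemR : ∀ y ∈ carrierCone A w, y ∈ Submodule.span ℝ R := by
    intro y hy
    obtain ⟨T, -, hT, c, -, hsum⟩ := exists_simplicial_decomposition hA hnd y
    rw [hsum]
    exact Submodule.sum_mem _ fun ρ hρ => Submodule.smul_mem _ _
      (Submodule.subset_span ⟨carrierCone_subset hy (hT ρ hρ).1, (hT ρ hρ).2⟩)
  have hR : Submodule.span ℝ R = ⊤ := by
    refine eq_top_iff.mpr fun y _ => ?_
    obtain ⟨ε, hε, hmem⟩ := exists_add_smul_mem_carrierCone (A := A) (x := w) (y := y) hA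
      (hw ▸ Submodule.mem_top)
    have h1 := hmemR _ hmem
    have h2 := (Submodule.add_mem_iff_right _ (hmemR w self_mem_carrierCone)).mp h1
    exact (Submodule.smul_mem_iff _ hε.ne').mp h2
  obtain ⟨T, hT, hTρ, c, hc, hsum⟩ := exists_simplicial_decomposition hA hnd x
  have hTR : (T : Set (Fin n → ℝ)) ⊆ R :=
    fun ρ hρ => ⟨carrierCone_subset hxw (hTρ ρ hρ).1, (hTρ ρ hρ).2⟩
  obtain ⟨b, hbR, hTb, hRb, hb⟩ := exists_linearIndepOn_id_extension hT hTR
  have hbtop : ⊤ ≤ Submodule.span ℝ (Set.range ((↑) : b → Fin n → ℝ)) := by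
    rw [Subtype.range_coe, ← hR]
    exact Submodule.span_le.mpr hRb
  let B := Module.Basis.mk (v := ((↑) : b → Fin n → ℝ)) hb hbtop
  have : Fintype b := Module.Basis.fintypeIndexOfRankLtAleph0 B (Module.rank_lt_aleph0 ℝ _)
  have hcard : Fintype.card b = Fintype.card (Fin n) := by
    rw [← Module.finrank_eq_card_basis B]; simp
  let e : Fin n ≃ b := (Fintype.equivOfCardEq hcard).symm
  refine ⟨fun j => e j, LinearIndependent.comp hb e e.injective, fun j => (hbR (e j).2).2,
    ⟨w, fun j => (hbR (e j).2).1⟩, fun j => if (e j : Fin n → ℝ) ∈ T then c (e j) else 0,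
    fun j => ?_, ?_⟩
  · dsimp only
    split_ifs
    exacts [hc _, le_rfl]
  · rw [Equiv.sum_comp e fun v : b => (if (v : Fin n → ℝ) ∈ T then c v else 0) • (v : Fin n → ℝ),
      hsum]
    have h1 : ∑ v : b, (if (v : Fin n → ℝ) ∈ T then c v else 0) • (v : Fin n → ℝ) =
        ∑ v ∈ b.toFinset, (if v ∈ T then c v else 0) • v := by
      rw [← Finset.sum_coe_sort b.toFinset]
      exact Fintype.sum_equiv (Equiv.subtypeEquivRight (by simp)) _ _ fun _ => rfl
    have h2 : T ⊆ b.toFinset := fun v hv => Set.mem_toFinset.mpr (hTb hv)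
    rw [h1, ← Finset.sum_subset h2 fun v _ hv => by rw [if_neg hv, zero_smul]]
    exact Finset.sum_congr rfl fun v hv => by rw [if_pos hv]

theorem finite_setOf_isMinimalRayGenerator (hA : ∀ i, (A i).Nonempty) :
    {ρ | IsMinimalRayGenerator A ρ}.Finite := by
  -- a ray generator is determined by its faces
  have key : ∀ ρ, IsMinimalRayGenerator A ρ →
      carrierCone A ρ = {x | ∃ t : ℝ, 0 ≤ t ∧ x = t • ρ} := by
    rintro ρ ⟨-, ⟨σ, hσ, hdim, hray⟩, -⟩
    obtain ⟨w, rfl⟩ := (isFanCone_iff hA).mp hσ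
    obtain ⟨t, ht, hw⟩ : w ∈ {x | ∃ t : ℝ, 0 ≤ t ∧ x = t • ρ} := hray ▸ self_mem_carrierCone
    rw [← hray]
    rcases ht.eq_or_lt with rfl | ht
    · -- the smallest cone containing `0` is a linear space, so that it is not a ray
      rw [zero_smul] at hw
      subst hw
      have hmem : ρ ∈ carrierCone A 0 := hray ▸ (⟨1, zero_le_one, (one_smul _ _).symm⟩ :
        ρ ∈ {x | ∃ t : ℝ, 0 ≤ t ∧ x = t • ρ})
      refine subset_antisymm (carrierCone_subset hmem) fun y hy i => ?_
      have h0 : faceOf (A i) ρ ⊆ faceOf (A i) 0 := fun a ha => by rw [faceOf_zero]; exact ha.1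
      exact h0.trans (hy i)
    · have : ∀ i, faceOf (A i) w = faceOf (A i) ρ := fun i => by rw [hw, faceOf_smul ht]
      simp only [carrierCone, this]
  have hinj : Set.InjOn (fun ρ i => faceOf (A i) ρ) {ρ | IsMinimalRayGenerator A ρ} := by
    intro ρ hρ ρ' hρ' h
    have h1 : carrierCone A ρ = carrierCone A ρ' := by
      have : ∀ i, faceOf (A i) ρ = faceOf (A i) ρ' := fun i => congrFun h i
      simp only [carrierCone, this]
    obtain ⟨t, ht, hρt⟩ := key ρ' hρ' ▸ h1 ▸ self_mem_carrierCone (A := A) (x := ρ)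
    obtain ⟨s, hs, hρs⟩ := key ρ hρ ▸ h1.symm ▸ self_mem_carrierCone (A := A) (x := ρ')
    have hρ0 := hρ.ne_zero
    have hρ0' := hρ'.ne_zero
    have ht' : 0 < t := ht.lt_of_ne (by rintro rfl; simp [hρt] at hρ0)
    have hs' : 0 < s := hs.lt_of_ne (by rintro rfl; simp [hρs] at hρ0')
    have h2 := hρ'.2.2 t ht' (hρt ▸ hρ.1)
    have h3 := hρ.2.2 s hs' (hρs ▸ hρ'.1)
    have h4 : (t * s) • ρ = (1 : ℝ) • ρ := by rw [mul_smul, ← hρs, ← hρt, one_smul]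
    have h5 : t * s = 1 := smul_left_injective ℝ hρ0 h4
    have h6 : t = 1 := by nlinarith
    rw [hρt, h6, one_smul]
  refine Set.Finite.of_finite_image (Set.Finite.subset (Set.Finite.pi' fun i =>
    (A i).finite_toSet.finite_subsets) ?_) hinj
  rintro _ ⟨ρ, -, rfl⟩ i
  exact fun a ha => ha.1

/-- A basis of ray generators adapted to the half-line `r + t η`, `t → ∞`: the coordinates of the
direction are non-negative, and so are those of `r` wherever the direction vanishes. -/
theorem exists_basis_lex_decomposition (hA : ∀ i, (A i).Nonempty) (hnd : IsNondegenerate A)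
    (r η : Fin n → ℝ) :
    ∃ ξ : Fin n → Fin n → ℝ, LinearIndependent ℝ ξ ∧ (∀ j, IsMinimalRayGenerator A (ξ j)) ∧
      (∃ w, ∀ j, ξ j ∈ carrierCone A w) ∧
      ∃ α β : Fin n → ℝ, r = ∑ j, α j • ξ j ∧ η = ∑ j, β j • ξ j ∧
        ∀ j, 0 ≤ β j ∧ (β j = 0 → 0 ≤ α j) := by
  choose ξ hξ hmin hw c hc hsum using
    fun t : ℕ => exists_basis_decomposition hA hnd (r + (t : ℝ) • η)
  have : Finite {ρ | IsMinimalRayGenerator A ρ} := finite_setOf_isMinimalRayGenerator hA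
  -- infinitely many `t` have the same basis
  obtain ⟨g, hg⟩ := Finite.exists_infinite_fiber
    (fun (t : ℕ) (j : Fin n) => (⟨ξ t j, hmin t j⟩ : {ρ | IsMinimalRayGenerator A ρ}))
  have hg' : Set.Infinite {t : ℕ | ξ t = fun j => (g j : Fin n → ℝ)} := by
    refine (Set.infinite_coe_iff.mp hg).mono fun t ht => ?_
    funext j
    exact congrArg Subtype.val (congrFun ht j)
  obtain ⟨t₀, ht₀⟩ := hg'.nonempty
  let b := basisOfLinearIndependentOfCardEqFinrank' (ξ t₀) (hξ t₀) (by simp)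
  have hb : ∀ j, b j = ξ t₀ j := fun j => by simp [b]
  refine ⟨ξ t₀, hξ t₀, hmin t₀, hw t₀, fun j => b.repr r j, fun j => b.repr η j, ?_, ?_, fun j => ?_⟩
  · simp only [← hb]; exact (b.sum_repr r).symm
  · simp only [← hb]; exact (b.sum_repr η).symm
  have hnn : ∀ N : ℕ, ∃ t : ℕ, N < t ∧ 0 ≤ b.repr r j + t * b.repr η j := by
    intro N
    obtain ⟨t, ht, hN⟩ := hg'.exists_gt N
    refine ⟨t, hN, ?_⟩
    have h1 : r + (t : ℝ) • η = ∑ j, c t j • b j := by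
      rw [hsum t]
      simp only [hb, show ξ t = ξ t₀ from Eq.trans ht (Eq.symm ht₀)]
    have h2 : b.repr (r + (t : ℝ) • η) j = c t j := by
      rw [h1, b.repr_sum_self]
    rw [map_add, map_smul] at h2
    have h3 : b.repr r j + t * b.repr η j = c t j := by simpa using h2
    rw [h3]
    exact hc t j
  refine ⟨?_, fun h0 => ?_⟩ <;> dsimp only at *
  · by_contra! hneg
    obtain ⟨N, hN⟩ := exists_nat_gt (b.repr r j / -b.repr η j)
    obtain ⟨t, ht, h⟩ := hnn N
    have h1 : b.repr r j < N * -b.repr η j := (div_lt_iff₀ (by linarith)).mp hN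
    have h2 : (N : ℝ) ≤ t := by exact_mod_cast ht.le
    nlinarith
  · obtain ⟨t, -, h⟩ := hnn 0
    rw [h0] at h
    simpa using h

end Rays

/-! ### Farkas' lemma over an ordered field -/

/-- Either `g` is a non-negative combination of the `w i`, or a linear form separates it from
them. -/
theorem exists_nonneg_combination_or_separating {K E ι : Type*} [Field K] [LinearOrder K]
    [IsStrictOrderedRing K] [AddCommGroup E] [Module K E] (s : Finset ι) (w : ι → E) (g : E) :
    (∃ u : ι → K, (∀ i, 0 ≤ u i) ∧ g = ∑ i ∈ s, u i • w i) ∨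
      ∃ f : E →ₗ[K] K, (∀ i ∈ s, 0 ≤ f (w i)) ∧ f g < 0 := by
  classical
  induction s using Finset.induction_on generalizing w g with
  | empty =>
    by_cases hg : g = 0
    · exact Or.inl ⟨0, fun _ => le_rfl, by simp [hg]⟩
    · obtain ⟨f, hf⟩ : ∃ f : Module.Dual K E, f g ≠ 0 := by
        by_contra! h
        exact hg ((Module.forall_dual_apply_eq_zero_iff K g).mp h)
      rcases lt_or_gt_of_ne hf with h | h
      · exact Or.inr ⟨f, by simp, h⟩
      · exact Or.inr ⟨-f, by simp, by simpa using h⟩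
  | insert j s hj ih =>
    rcases ih w g with ⟨u, hu, hg⟩ | ⟨f, hf, hfg⟩
    · refine Or.inl ⟨Function.update u j 0, fun i => ?_, ?_⟩
      · by_cases h : i = j
        · subst h; simp
        · simpa [h] using hu i
      · rw [Finset.sum_insert hj, Function.update_self, zero_smul, zero_add, hg]
        exact Finset.sum_congr rfl fun i hi => by
          rw [Function.update_of_ne (ne_of_mem_of_not_mem hi hj)]
    by_cases hfj : 0 ≤ f (w j)
    · refine Or.inr ⟨f, fun i hi => ?_, hfg⟩
      rcases Finset.mem_insert.mp hi with rfl | hi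
      exacts [hfj, hf i hi]
    have hneg : f (w j) < 0 := not_le.mp hfj
    -- project to the kernel of `f` along `w j`
    rcases ih (fun i => w i - (f (w i) / f (w j)) • w j) (g - (f g / f (w j)) • w j) with
      ⟨u, hu, hg⟩ | ⟨f', hf', hfg'⟩
    · refine Or.inl ⟨Function.update u j (f g / f (w j) - ∑ i ∈ s, u i * (f (w i) / f (w j))),
        fun i => ?_, ?_⟩
      · by_cases h : i = j
        · subst h
          rw [Function.update_self, sub_nonneg]
          refine (Finset.sum_nonpos fun k hk => ?_).trans (div_nonneg_of_nonpos hfg.le hneg.le)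
          exact mul_nonpos_of_nonneg_of_nonpos (hu k)
            (div_nonpos_of_nonneg_of_nonpos (hf k hk) hneg.le)
        · simpa [h] using hu i
      · rw [Finset.sum_insert hj, Function.update_self,
          Finset.sum_congr rfl (g := fun i => u i • w i) fun i hi => by
            rw [Function.update_of_ne (ne_of_mem_of_not_mem hi hj)]]
        have h1 : g = (f g / f (w j)) • w j +
            ∑ i ∈ s, u i • (w i - (f (w i) / f (w j)) • w j) := by
          rw [← hg]; abel
        simp only [smul_sub, Finset.sum_sub_distrib, smul_smul, ← Finset.sum_smul] at h1
        rw [sub_smul]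
        calc g = _ := h1
          _ = _ := by abel
    · refine Or.inr ⟨f' - (f' (w j) / f (w j)) • f, fun i hi => ?_, ?_⟩
      · rcases Finset.mem_insert.mp hi with rfl | hi
        · simp [div_mul_cancel₀ _ hneg.ne]
        · have := hf' i hi
          rw [map_sub, map_smul, smul_eq_mul] at this
          simp only [LinearMap.sub_apply, LinearMap.smul_apply, smul_eq_mul]
          calc 0 ≤ _ := this
            _ = _ := by ring
      · rw [map_sub, map_smul, smul_eq_mul] at hfg'
        simp only [LinearMap.sub_apply, LinearMap.smul_apply, smul_eq_mul]
        calc _ = _ := by ring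
          _ < 0 := hfg'

/-! ### Solutions of the binomial equations -/

section Binomials

variable {n : ℕ} {A : Fin n → Finset (Fin n → ℤ)}

/-- The exponent of the coordinate `(i, a)` of the multi-cone over the toric variety: the degree
in the `i`-th factor together with `a`. -/
def expVec (s : Σ i, A i) : (Fin n → ℤ) × (Fin n → ℤ) :=
  (Pi.single s.1 1, s.2.1)

/-- The binomial equations of the toric variety. -/
def SatisfiesBinomials (x : (Σ i, A i) → ℂ) : Prop :=
  ∀ m m' : (Σ i, A i) → ℕ, ∑ s, m s • expVec s = ∑ s, m' s • expVec s →
    ∏ s, x s ^ m s = ∏ s, x s ^ m' s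

/-- The character of the torus `(ℂˣ)ⁿ × (ℂˣ)ⁿ` at the point `(c, Z)`. -/
def torusChar (c Z : Fin n → ℂˣ) : (Fin n → ℤ) × (Fin n → ℤ) →+ Additive ℂˣ :=
  AddMonoidHom.mk' (fun p => Additive.ofMul ((∏ i, c i ^ p.1 i) * ∏ k, Z k ^ p.2 k)) fun p q => by
    rw [← ofMul_mul]
    congr 1
    simp only [Prod.fst_add, Prod.snd_add, Pi.add_apply, zpow_add, Finset.prod_mul_distrib]
    exact mul_mul_mul_comm _ _ _ _

theorem torusChar_expVec (c Z : Fin n → ℂˣ) (s : Σ i, A i) :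
    (torusChar c Z (expVec s)).toMul = c s.1 * ∏ k, Z k ^ s.2.1 k := by
  have : ∏ i, c i ^ (Pi.single s.1 1 : Fin n → ℤ) i = c s.1 := by
    rw [Finset.prod_eq_single s.1 (fun j _ hj => by simp [hj]) (by simp)]
    simp
  simp [torusChar, expVec, this]

theorem satisfiesBinomials_torus (c Z : Fin n → ℂˣ) :
    SatisfiesBinomials fun s : Σ i, A i => ((c s.1 : ℂ) * ∏ k, (Z k : ℂ) ^ s.2.1 k) := by
  intro m m' h
  have key : ∀ m : (Σ i, A i) → ℕ, ∏ s, ((c s.1 : ℂ) * ∏ k, (Z k : ℂ) ^ s.2.1 k) ^ m s =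
      ((torusChar c Z (∑ s, m s • expVec s)).toMul : ℂˣ) := by
    intro m
    rw [map_sum, toMul_sum, Units.coe_prod]
    refine Finset.prod_congr rfl fun s _ => ?_
    rw [map_nsmul, toMul_nsmul, torusChar_expVec]
    simp
  rw [key, key, h]

theorem satisfiesBinomials_of_mem_toricVariety {v : MultiProj A} (hv : v ∈ toricVariety A) :
    SatisfiesBinomials fun s : Σ i, A i => (v s.1).rep s.2 := by
  intro m m' h
  let F : MvPolynomial (Σ i, A i) ℂ :=
    MvPolynomial.monomial (Finsupp.equivFunOnFinite.symm m) 1 -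
      MvPolynomial.monomial (Finsupp.equivFunOnFinite.symm m') 1
  have hF : ∀ x : (Σ i, A i) → ℂ,
      MvPolynomial.eval x F = ∏ s, x s ^ m s - ∏ s, x s ^ m' s := fun x => by
    simp [F, MvPolynomial.eval_monomial, Finsupp.prod_fintype]
  have hw : ∀ m : (Σ i, A i) → ℕ, Finsupp.weight
      (fun s : (Σ i, A i) => (Pi.single s.1 1 : Fin n → ℕ)) (Finsupp.equivFunOnFinite.symm m) =
      ∑ s, m s • (Pi.single s.1 1 : Fin n → ℕ) := fun m => by
    rw [Finsupp.weight_apply, Finsupp.sum_fintype _ _ (by simp)]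
    rfl
  have hdeg : ∑ s, m' s • (Pi.single s.1 1 : Fin n → ℕ) =
      ∑ s, m s • (Pi.single s.1 1 : Fin n → ℕ) := by
    funext i
    have h1 := congrFun (congrArg Prod.fst h) i
    have h2 : ∀ m : (Σ i, A i) → ℕ, (∑ s, m s • expVec s).1 i =
        ((∑ s, m s • (Pi.single s.1 1 : Fin n → ℕ)) i : ℕ) := fun m => by
      simp [expVec, Prod.fst_sum, Finset.sum_apply, Pi.single_apply]
    have h3 := h2 m
    rw [h1, h2] at h3
    exact_mod_cast h3
  have := hv F (∑ s, m s • (Pi.single s.1 1 : Fin n → ℕ))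
    ((MvPolynomial.isWeightedHomogeneous_monomial _ _ _ (hw m)).sub
      (MvPolynomial.isWeightedHomogeneous_monomial _ _ _ ((hw m').trans hdeg))) ?_
  · rw [VanishesAt, hF] at this
    exact sub_eq_zero.mp this
  · rintro u ⟨Z, hZ⟩
    choose h0 hu using hZ
    choose c hc using fun i => Projectivization.exists_smul_eq_mk_rep ℂ _ (h0 i)
    have hrep : ∀ s : Σ i, A i, (u s.1).rep s.2 = (c s.1 : ℂ) * ∏ k, (Z k : ℂ) ^ s.2.1 k :=
      fun s => by rw [hu, ← hc]; rfl
    rw [VanishesAt, hF, sub_eq_zero]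
    simp only [hrep]
    exact satisfiesBinomials_torus c Z m m' h

variable {x : (Σ i, A i) → ℂ}

theorem SatisfiesBinomials.int (hx : SatisfiesBinomials x) (m : (Σ i, A i) → ℤ)
    (h : ∑ s, m s • expVec s = 0) :
    ∏ s, x s ^ (m s).toNat = ∏ s, x s ^ (-m s).toNat := by
  refine hx _ _ (sub_eq_zero.mp ?_)
  rw [← Finset.sum_sub_distrib, ← h]
  refine Finset.sum_congr rfl fun s _ => ?_
  rw [← natCast_zsmul, ← natCast_zsmul, ← sub_smul, Int.toNat_sub_toNat_neg]

/-- A vanishing coordinate of a solution of the binomial equations is separated from the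
non-vanishing ones by a linear form that is non-negative on all exponents: otherwise a binomial
relation has a vanishing and a non-vanishing side. -/
theorem SatisfiesBinomials.exists_separating (hx : SatisfiesBinomials x) (s₀ : Σ i, A i)
    (hs₀ : x s₀ = 0) :
    ∃ f : (Fin n → ℚ) × (Fin n → ℚ) →ₗ[ℚ] ℚ,
      (∀ s : Σ i, A i, 0 ≤ f (fun i => (expVec s).1 i, fun k => (expVec s).2 k)) ∧
      (∀ s, x s ≠ 0 → f (fun i => (expVec s).1 i, fun k => (expVec s).2 k) = 0) ∧
      0 < f (fun i => (expVec s₀).1 i, fun k => (expVec s₀).2 k) := by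
  classical
  set w : (Σ i, A i) → (Fin n → ℚ) × (Fin n → ℚ) :=
    fun s => (fun i => (expVec s).1 i, fun k => (expVec s).2 k)
  rcases exists_nonneg_combination_or_separating (K := ℚ)
    (Finset.univ : Finset ((Σ i, A i) ⊕ (Σ i, A i)))
    (Sum.elim w fun s => if x s ≠ 0 then -w s else 0) (-w s₀) with ⟨u, hu, hsum⟩ | ⟨f, hf, hf0⟩
  · exfalso
    let r : (Σ i, A i) → ℚ := fun s =>
      u (Sum.inl s) - (if x s ≠ 0 then u (Sum.inr s) else 0) + if s = s₀ then 1 else 0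
    have hr : ∑ s, r s • w s = 0 := by
      simp only [r, add_smul, sub_smul, Finset.sum_add_distrib, Finset.sum_sub_distrib, ite_smul,
        one_smul, zero_smul, Finset.sum_ite_eq', Finset.mem_univ, if_true]
      rw [Fintype.sum_sum_type] at hsum
      simp only [Sum.elim_inl, Sum.elim_inr, smul_ite, smul_neg, smul_zero] at hsum
      rw [eq_comm, neg_eq_iff_eq_neg.mp hsum, sub_eq_add_neg, ← Finset.sum_neg_distrib]
      have : ∀ s, -(if x s ≠ 0 then u (Sum.inr s) • w s else 0) =
          if x s ≠ 0 then -(u (Sum.inr s) • w s) else 0 := fun s => by split_ifs <;> simp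
      simp only [this]
      abel
    have hr0 : 0 < r s₀ := by
      have := hu (Sum.inl s₀)
      simp only [r, hs₀, ne_eq, not_true_eq_false, if_false, if_true]
      linarith
    have hrnn : ∀ s, x s = 0 → 0 ≤ r s := fun s hs => by
      have := hu (Sum.inl s)
      simp only [r, hs, ne_eq, not_true_eq_false, if_false]
      split_ifs <;> linarith
    obtain ⟨N, hN⟩ := IsLocalization.exist_integer_multiples_of_finite (nonZeroDivisors ℤ) r
    choose q hq using hN
    have hq' : ∀ s, (q s : ℚ) = (N : ℤ) * r s := fun s => by
      have := hq s
      simpa [Algebra.smul_def] using this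
    have hN0 : ((N : ℤ) : ℚ) ≠ 0 := by exact_mod_cast nonZeroDivisors.ne_zero N.2
    -- multiplying by the square of the common denominator keeps the signs
    have hm : ∀ s, ((N * q s : ℤ) : ℚ) = (N : ℤ) ^ 2 * r s := fun s => by
      push_cast
      rw [hq']
      ring
    have hN2 : 0 < ((N : ℤ) : ℚ) ^ 2 := by positivity
    have hrel : ∑ s, (N * q s : ℤ) • expVec s = 0 := by
      have h1 : ∑ s, ((N * q s : ℤ) : ℚ) • w s = 0 := by
        simp only [hm, mul_smul, ← Finset.smul_sum, hr, smul_zero]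
      ext i
      · have h2 := congrFun (congrArg Prod.fst h1) i
        simp only [Prod.fst_sum, Prod.smul_fst, Finset.sum_apply, Pi.smul_apply, smul_eq_mul, w,
          Prod.fst_zero, Pi.zero_apply] at h2 ⊢
        exact_mod_cast h2
      · have h2 := congrFun (congrArg Prod.snd h1) i
        simp only [Prod.snd_sum, Prod.smul_snd, Finset.sum_apply, Pi.smul_apply, smul_eq_mul, w,
          Prod.snd_zero, Pi.zero_apply] at h2 ⊢
        exact_mod_cast h2
    have hprod := hx.int _ hrel
    have hpos : 0 < (N : ℤ) * q s₀ := by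
      have : (0 : ℚ) < ((N * q s₀ : ℤ) : ℚ) := by rw [hm]; positivity
      exact_mod_cast this
    rw [Finset.prod_eq_zero (Finset.mem_univ s₀)
      (by rw [hs₀, zero_pow (by omega)])] at hprod
    refine Finset.prod_ne_zero_iff.mpr (fun s _ => ?_) hprod.symm
    by_cases hs : x s = 0
    · have : (0 : ℚ) ≤ ((N * q s : ℤ) : ℚ) := by
        rw [hm]; exact mul_nonneg hN2.le (hrnn s hs)
      have h2 : 0 ≤ (N : ℤ) * q s := by exact_mod_cast this
      rw [Int.toNat_of_nonpos (by omega), pow_zero]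
      exact one_ne_zero
    · exact pow_ne_zero _ hs
  · refine ⟨f, fun s => hf (Sum.inl s) (Finset.mem_univ _), fun s hs => ?_, by simpa using hf0⟩
    have h1 := hf (Sum.inl s) (Finset.mem_univ _)
    have h2 := hf (Sum.inr s) (Finset.mem_univ _)
    simp only [Sum.elim_inl, Sum.elim_inr, if_pos hs, map_neg] at h1 h2
    exact le_antisymm (by linarith) h1

/-- The non-vanishing coordinates of a solution of the binomial equations form a face. -/
theorem SatisfiesBinomials.exists_face (hx : SatisfiesBinomials x)
    (hne : ∀ i, ∃ a, x ⟨i, a⟩ ≠ 0) :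
    ∃ ξ : Fin n → ℝ, ∀ i, ∀ a : A i, x ⟨i, a⟩ ≠ 0 ↔ a.1 ∈ faceOf (A i) ξ := by
  classical
  set w : (Σ i, A i) → (Fin n → ℚ) × (Fin n → ℚ) :=
    fun s => (fun i => (expVec s).1 i, fun k => (expVec s).2 k) with hw
  have hf : ∀ s₀, ∃ f : (Fin n → ℚ) × (Fin n → ℚ) →ₗ[ℚ] ℚ, (∀ s, 0 ≤ f (w s)) ∧
      (∀ s, x s ≠ 0 → f (w s) = 0) ∧ (x s₀ = 0 → 0 < f (w s₀)) := by
    intro s₀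
    by_cases h : x s₀ = 0
    · obtain ⟨f, h1, h2, h3⟩ := hx.exists_separating s₀ h
      exact ⟨f, h1, h2, fun _ => h3⟩
    · exact ⟨0, by simp, by simp, fun h' => absurd h' h⟩
  choose f hf1 hf2 hf3 using hf
  let F := ∑ s, f s
  have hF0 : ∀ s, x s ≠ 0 → F (w s) = 0 := fun s hs => by
    simp only [F, LinearMap.sum_apply]
    exact Finset.sum_eq_zero fun t _ => hf2 t s hs
  have hFpos : ∀ s, x s = 0 → 0 < F (w s) := fun s hs => by
    simp only [F, LinearMap.sum_apply]
    exact Finset.sum_pos' (fun t _ => hf1 t s) ⟨s, Finset.mem_univ _, hf3 s hs⟩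
  let ξ : Fin n → ℝ := fun k => -((F (0, Pi.single k 1) : ℚ) : ℝ)
  let c : Fin n → ℚ := fun i => F (Pi.single i 1, 0)
  have hval : ∀ i, ∀ a : A i, pairing a.1 ξ = ((c i - F (w ⟨i, a⟩) : ℚ) : ℝ) := by
    intro i a
    have h1 : w ⟨i, a⟩ = (Pi.single i 1, 0) +
        ∑ k, (a.1 k : ℚ) • ((0, Pi.single k 1) : (Fin n → ℚ) × (Fin n → ℚ)) := by
      ext j
      · simp [hw, expVec, Prod.fst_sum, Pi.single_apply]
      · simp [hw, expVec, Prod.snd_sum, Finset.sum_apply, Pi.single_apply]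
    rw [h1, map_add, map_sum]
    simp only [map_smul, smul_eq_mul, pairing, ξ, c]
    push_cast
    simp
  refine ⟨ξ, fun i a => ?_⟩
  obtain ⟨b, hb⟩ := hne i
  have hnn : ∀ a : A i, 0 ≤ F (w ⟨i, a⟩) := fun a => by
    by_cases h : x ⟨i, a⟩ = 0
    exacts [(hFpos _ h).le, (hF0 _ h).ge]
  have hbmem : b.1 ∈ faceOf (A i) ξ := by
    refine ⟨b.2, fun a ha => ?_⟩
    rw [hval i ⟨a, ha⟩, hval i b, hF0 _ hb]
    have := hnn ⟨a, ha⟩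
    exact_mod_cast by linarith
  rw [mem_faceOf_iff hbmem, hval, hval, hF0 _ hb]
  constructor
  · intro ha
    rw [hF0 _ ha]
    exact ⟨a.2, rfl⟩
  · rintro ⟨-, h⟩ ha
    have := hFpos _ ha
    have h' : c i - F (w ⟨i, a⟩) = c i - 0 := by exact_mod_cast h
    linarith

/-- The non-vanishing coordinates of a solution of the binomial equations are those of a point of
the torus, because homomorphisms to the divisible group `ℂˣ` extend. -/
theorem SatisfiesBinomials.exists_torus (hx : SatisfiesBinomials x) :
    ∃ c Z : Fin n → ℂˣ, ∀ s, x s ≠ 0 → x s = (c s.1 : ℂ) * ∏ k, (Z k : ℂ) ^ s.2.1 k := by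
  classical
  let w : (Σ i, A i) → (Fin n → ℤ) × (Fin n → ℤ) := fun s => if x s ≠ 0 then expVec s else 0
  let X : (Σ i, A i) → ℂˣ := fun s => if h : x s ≠ 0 then Units.mk0 (x s) h else 1
  let W : ((Σ i, A i) → ℤ) →+ (Fin n → ℤ) × (Fin n → ℤ) :=
    AddMonoidHom.mk' (fun m => ∑ s, m s • w s) fun m m' => by
      simp only [Pi.add_apply, add_smul, Finset.sum_add_distrib]
  let V : ((Σ i, A i) → ℤ) →+ Additive ℂˣ :=
    AddMonoidHom.mk' (fun m => ∑ s, m s • Additive.ofMul (X s)) fun m m' => by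
      simp only [Pi.add_apply, add_zsmul, Finset.sum_add_distrib]
  have hker : W.ker ≤ V.ker := by
    intro m hm
    -- only the exponents of the non-vanishing coordinates matter
    let m' : (Σ i, A i) → ℤ := fun s => if x s ≠ 0 then m s else 0
    have h1 : ∑ s, m' s • expVec s = 0 := by
      rw [← (show ∑ s, m s • w s = 0 from hm)]
      refine Finset.sum_congr rfl fun s _ => ?_
      by_cases hs : x s = 0 <;> simp [m', w, hs]
    have h2 := hx.int m' h1
    have h3 : ∀ e : (Σ i, A i) → ℕ, (∀ s, x s = 0 → e s = 0) →
        ∏ s, x s ^ e s = ((∏ s, X s ^ e s : ℂˣ) : ℂ) := fun e he => by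
      push_cast
      refine Finset.prod_congr rfl fun s _ => ?_
      by_cases hs : x s = 0
      · simp [he s hs]
      · simp [X, hs]
    rw [h3 _ fun s hs => by simp [m', hs], h3 _ fun s hs => by simp [m', hs], Units.val_inj] at h2
    have h4 : ∏ s, X s ^ m s = 1 := by
      rw [← div_eq_one.mpr h2, ← Finset.prod_div_distrib]
      refine Finset.prod_congr rfl fun s _ => ?_
      by_cases hs : x s = 0
      · simp [X, hs]
      · have : m s = ((m' s).toNat : ℤ) - ((-m' s).toNat : ℤ) := by
          rw [Int.toNat_sub_toNat_neg]; simp [m', hs]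
        rw [this, zpow_sub, zpow_natCast, zpow_natCast, div_eq_mul_inv]
    change ∑ s, m s • Additive.ofMul (X s) = 0
    simp only [← ofMul_zpow, ← ofMul_prod, h4, ofMul_one]
  have hdiv : ∀ {m : ℤ}, m ≠ 0 → Function.Surjective fun z : Additive ℂˣ => m • z := by
    intro m hm z
    refine ⟨Additive.ofMul (Units.mk0 (Complex.exp (Complex.log (z.toMul : ℂˣ) / m))
      (Complex.exp_ne_zero _)), ?_⟩
    have hm' : (m : ℂ) ≠ 0 := by exact_mod_cast hm
    refine Additive.toMul.injective (Units.ext ?_)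
    change ((Units.mk0 _ (Complex.exp_ne_zero _) ^ m : ℂˣ) : ℂ) = _
    rw [Units.val_zpow_eq_zpow_val, Units.val_mk0, ← Complex.exp_int_mul, mul_div_cancel₀ _ hm',
      Complex.exp_log (Units.ne_zero _)]
  let _ : DivisibleBy (Additive ℂˣ) ℤ := divisibleByOfSMulRightSurj _ _ hdiv
  obtain ⟨h, hh⟩ := (Module.Baer.of_divisible (Additive ℂˣ)).extension_property_addMonoidHom
    (QuotientAddGroup.kerLift W) (QuotientAddGroup.kerLift_injective W)
    (QuotientAddGroup.lift W.ker V hker)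
  have hWV : ∀ m, h (W m) = V m := fun m => DFunLike.congr_fun hh (m : _ ⧸ W.ker)
  refine ⟨fun i => (h (Pi.single i 1, 0)).toMul, fun k => (h (0, Pi.single k 1)).toMul,
    fun s hs => ?_⟩
  have h1 : h (expVec s) = Additive.ofMul (X s) := by
    have := hWV (Pi.single s 1)
    have hW : W (Pi.single s 1) = expVec s := by
      change ∑ t, (Pi.single s 1 : _ → ℤ) t • w t = _
      rw [Finset.sum_eq_single s (fun t _ ht => by simp [ht]) (by simp)]
      simp [w, hs]
    have hV : V (Pi.single s 1) = Additive.ofMul (X s) := by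
      change ∑ t, (Pi.single s 1 : _ → ℤ) t • Additive.ofMul (X t) = _
      rw [Finset.sum_eq_single s (fun t _ ht => by simp [ht]) (by simp)]
      simp
    rwa [hW, hV] at this
  have h2 : expVec s = (Pi.single s.1 1, 0) +
      ∑ k, s.2.1 k • ((0, Pi.single k 1) : (Fin n → ℤ) × (Fin n → ℤ)) := by
    ext j
    · simp [expVec, Prod.fst_sum]
    · simp [expVec, Prod.snd_sum, Finset.sum_apply, Pi.single_apply]
  rw [h2, map_add, map_sum] at h1
  have h3 := congrArg (fun z : Additive ℂˣ => ((z.toMul : ℂˣ) : ℂ)) h1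
  simp only [toMul_add, toMul_sum, map_zsmul, toMul_zsmul, toMul_ofMul, Units.val_mul,
    Units.coe_prod, Units.val_zpow_eq_zpow_val] at h3
  rw [h3]
  simp [X, hs]

end Binomials

/-- A point of the toric variety is the limit, along the half-line in the direction `η`, of points
of the torus: its coordinates vanish off the faces of `η` and are torus coordinates on them. -/
theorem exists_face_torus_of_mem_toricVariety {n : ℕ} {A : Fin n → Finset (Fin n → ℤ)}
    {v : MultiProj A} (hv : v ∈ toricVariety A) :
    ∃ (η : Fin n → ℝ) (ζ : Fin n → ℂ), ∀ i, ∃ c : ℂ, c ≠ 0 ∧ ∀ a : A i,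
      (a.1 ∈ faceOf (A i) η → (v i).rep a = c * Complex.exp (∑ k, (a.1 k : ℂ) * ζ k)) ∧
      (a.1 ∉ faceOf (A i) η → (v i).rep a = 0) := by
  have hx := satisfiesBinomials_of_mem_toricVariety hv
  obtain ⟨η, hη⟩ := hx.exists_face fun i => by
    by_contra! h
    exact (v i).rep_nonzero (funext h)
  obtain ⟨c, Z, hZ⟩ := hx.exists_torus
  refine ⟨η, fun k => Complex.log (Z k), fun i => ⟨c i, (c i).ne_zero, fun a => ⟨fun ha => ?_,
    fun ha => ?_⟩⟩⟩
  · have := hZ ⟨i, a⟩ ((hη i a).mpr ha)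
    simp only at this
    rw [this, Complex.exp_sum]
    congr 1
    exact Finset.prod_congr rfl fun k _ => by
      rw [Complex.exp_int_mul, Complex.exp_log (Z k).ne_zero]
  · exact not_not.mp (mt (hη i a).mp ha)

/-! ### The image of a parameterization lies in the toric variety -/

section Image

variable {n : ℕ} {A : Fin n → Finset (Fin n → ℤ)}

theorem IsMultihomogeneous.eval_mul {F : MvPolynomial (Σ i, A i) ℂ} {d : Fin n → ℕ}
    (hF : IsMultihomogeneous F d) (c : Fin n → ℂ) (x : (Σ i, A i) → ℂ) :
    MvPolynomial.eval (fun s => c s.1 * x s) F = (∏ i, c i ^ d i) * MvPolynomial.eval x F := by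
  rw [MvPolynomial.eval_eq', MvPolynomial.eval_eq', Finset.mul_sum]
  refine Finset.sum_congr rfl fun e he => ?_
  have hd := hF (MvPolynomial.mem_support_iff.mp he)
  rw [Finsupp.weight_apply, Finsupp.sum_fintype _ _ (by simp)] at hd
  have hc : ∏ s, c s.1 ^ e s = ∏ i, c i ^ d i := by
    have h1 : ∀ s : Σ i, A i, c s.1 ^ e s =
        ∏ i, c i ^ (e s * (Pi.single s.1 1 : Fin n → ℕ) i) := fun s => by
      rw [Finset.prod_eq_single s.1 (fun j _ hj => by simp [hj]) (by simp)]
      simp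
    simp only [h1]
    rw [Finset.prod_comm]
    refine Finset.prod_congr rfl fun i _ => ?_
    rw [Finset.prod_pow_eq_pow_sum, ← hd]
    simp [Finset.sum_apply]
  simp only [mul_pow, Finset.prod_mul_distrib]
  rw [hc]
  ring

/-- The vanishing of a multihomogeneous polynomial may be tested on any representatives. -/
theorem IsMultihomogeneous.vanishesAt_iff {F : MvPolynomial (Σ i, A i) ℂ} {d : Fin n → ℕ}
    (hF : IsMultihomogeneous F d) {x : ∀ i, A i → ℂ} (hx : ∀ i, x i ≠ 0) :
    VanishesAt F (fun i => Projectivization.mk ℂ (x i) (hx i)) ↔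
      MvPolynomial.eval (fun s => x s.1 s.2) F = 0 := by
  choose c hc using fun i => Projectivization.exists_smul_eq_mk_rep ℂ _ (hx i)
  rw [VanishesAt]
  simp only [← hc]
  have := hF.eval_mul (fun i => (c i : ℂ)) (fun s => x s.1 s.2)
  simp only [Pi.smul_apply, Units.smul_def, smul_eq_mul]
  rw [this, mul_eq_zero, or_iff_right]
  exact Finset.prod_ne_zero_iff.mpr fun i _ => pow_ne_zero _ (c i).ne_zero

/-- The point of the source of a parameterization with logarithmic coordinates `-z`, where the
polynomial coordinates with `t j ≠ 0` are replaced by zero. -/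
noncomputable def chartPoint {l m : ℕ} (t : Fin l → ℝ) (z : Fin l ⊕ Fin m → ℂ) :
    (Fin l → ℂ) × (Fin m → ℂ) :=
  (fun j => if t j = 0 then Complex.exp (-z (Sum.inl j)) else 0, fun j => -z (Sum.inr j))

theorem omegaCoord_chartPoint {l : ℕ} {ξ : Fin l ⊕ Fin (n - l) → Fin n → ℝ} {θ a : Fin n → ℤ}
    (hk : ∀ j, ∃ k : ℕ, pairing (a - θ) (-ξ j) = k) (t : Fin l → ℝ)
    (z : Fin l ⊕ Fin (n - l) → ℂ) :
    ((∀ j, t j ≠ 0 → pairing (a - θ) (ξ (Sum.inl j)) = 0) →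
      OmegaCoord ξ θ a (chartPoint t z) =
        Complex.exp (∑ j, z j * (pairing (a - θ) (ξ j) : ℝ))) ∧
    ((∃ j, t j ≠ 0 ∧ pairing (a - θ) (ξ (Sum.inl j)) ≠ 0) →
      OmegaCoord ξ θ a (chartPoint t z) = 0) := by
  choose k hk using hk
  have hk' : ∀ j, pairing (a - θ) (ξ j) = -k j := fun j => by
    rw [← hk, pairing_neg, neg_neg]
  constructor
  · intro h
    rw [OmegaCoord, Fintype.sum_sum_type, Complex.exp_add]
    congr 1
    · rw [Complex.exp_sum]
      refine Finset.prod_congr rfl fun j _ => ?_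
      simp only [chartPoint]
      rw [hk, Complex.ofReal_natCast, Complex.cpow_natCast]
      split_ifs with ht
      · rw [← Complex.exp_nat_mul, hk']
        congr 1
        push_cast
        ring
      · have h0 : k (Sum.inl j) = 0 := by
          have := h j ht
          rw [hk', neg_eq_zero] at this
          exact_mod_cast this
        rw [h j ht, h0]
        simp
    · congr 1
      refine Finset.sum_congr rfl fun j _ => ?_
      simp only [chartPoint, pairing_neg]
      push_cast
      ring
  · rintro ⟨j, ht, hj⟩
    rw [OmegaCoord, mul_eq_zero]
    refine Or.inl (Finset.prod_eq_zero (Finset.mem_univ j) ?_)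
    have h0 : k (Sum.inl j) ≠ 0 := by
      rintro h0
      rw [hk', h0] at hj
      simp at hj
    simp only [chartPoint]
    rw [hk, Complex.ofReal_natCast, Complex.cpow_natCast, if_neg ht, zero_pow h0]

namespace Parameterization

variable (c : Parameterization A)

theorem continuous_omegaVec (i : Fin n) :
    Continuous fun p => OmegaVec c.ξ (c.θ i) (A i) p := by
  refine continuous_pi fun a => ?_
  choose k hk using c.exponent_nat i a.1 a.2
  simp only [OmegaVec, OmegaCoord, hk, Complex.ofReal_natCast, Complex.cpow_natCast]
  fun_prop

theorem mem_faceOf_ξ (hθ : ∀ i, c.θ i ∈ A i) (i : Fin n) (j) :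
    c.θ i ∈ faceOf (A i) (c.ξ j) := by
  refine ⟨hθ i, fun a ha => ?_⟩
  obtain ⟨k, hk⟩ := c.exponent_nat i a ha j
  rw [pairing_neg, pairing_sub_left] at hk
  have : (0 : ℝ) ≤ k := k.cast_nonneg
  linarith

theorem pairing_sub_nonpos (hθ : ∀ i, c.θ i ∈ A i) {i : Fin n} {a} (ha : a ∈ A i) (j) :
    pairing (a - c.θ i) (c.ξ j) ≤ 0 := by
  rw [pairing_sub_left, sub_nonpos]
  exact (c.mem_faceOf_ξ hθ i j).2 a ha

theorem θ_mem_faceOf_sum (hθ : ∀ i, c.θ i ∈ A i) {t : Fin c.l → ℝ} (ht : ∀ j, 0 ≤ t j)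
    (i : Fin n) : c.θ i ∈ faceOf (A i) (∑ j, t j • c.ξ (Sum.inl j)) :=
  mem_faceOf_sum_smul _ (fun j _ => ht j) (hθ i) fun _ _ => c.mem_faceOf_ξ hθ i _

/-- A point lies in a face of a non-negative combination of the `ξ j` exactly if it lies in the
corresponding faces of all `ξ j` that occur. -/
theorem mem_faceOf_sum_iff (hθ : ∀ i, c.θ i ∈ A i) {t : Fin c.l → ℝ} (ht : ∀ j, 0 ≤ t j)
    {i : Fin n} {a} (ha : a ∈ A i) :
    a ∈ faceOf (A i) (∑ j, t j • c.ξ (Sum.inl j)) ↔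
      ∀ j, t j ≠ 0 → pairing (a - c.θ i) (c.ξ (Sum.inl j)) = 0 := by
  rw [mem_faceOf_iff (c.θ_mem_faceOf_sum hθ ht i), ← sub_eq_zero, ← pairing_sub_left,
    pairing_sum_smul, Finset.sum_eq_zero_iff_of_nonpos fun j _ =>
      mul_nonpos_of_nonneg_of_nonpos (ht j) (c.pairing_sub_nonpos hθ ha _)]
  simp only [ha, true_and, Finset.mem_univ, true_implies, mul_eq_zero, or_iff_not_imp_left]

/-- A point of the toric variety given by a direction `η` and a torus point `exp ζ` is the value of
a parameterization as soon as `η` is a non-negative combination of its polynomial rays. -/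
theorem toFun_chartPoint (hθ : ∀ i, c.θ i ∈ A i) {t : Fin c.l → ℝ} (ht : ∀ j, 0 ≤ t j)
    {ζ : Fin n → ℂ} {z : Fin c.l ⊕ Fin (n - c.l) → ℂ}
    (hζ : ∀ a : Fin n → ℤ, ∑ k, (a k : ℂ) * ζ k = ∑ j, z j * (pairing a (c.ξ j) : ℝ))
    {v : MultiProj A} (hv : ∀ i, ∃ r : ℂ, r ≠ 0 ∧ ∀ a : A i,
      (a.1 ∈ faceOf (A i) (∑ j, t j • c.ξ (Sum.inl j)) →
        (v i).rep a = r * Complex.exp (∑ k, (a.1 k : ℂ) * ζ k)) ∧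
      (a.1 ∉ faceOf (A i) (∑ j, t j • c.ξ (Sum.inl j)) → (v i).rep a = 0)) :
    c.toFun (chartPoint t z) = v := by
  funext i
  obtain ⟨r, hr, h⟩ := hv i
  have he := Complex.exp_ne_zero (∑ k, (c.θ i k : ℂ) * ζ k)
  rw [← (v i).mk_rep, toFun, Projectivization.mk_eq_mk_iff']
  refine ⟨(r * Complex.exp (∑ k, (c.θ i k : ℂ) * ζ k))⁻¹, funext fun a => ?_⟩
  rw [Pi.smul_apply, smul_eq_mul, OmegaVec]
  have hΩ := omegaCoord_chartPoint (c.exponent_nat i a.1 a.2) t z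
  by_cases ha : a.1 ∈ faceOf (A i) (∑ j, t j • c.ξ (Sum.inl j))
  · rw [(h a).1 ha, hΩ.1 ((c.mem_faceOf_sum_iff hθ ht a.2).mp ha), ← hζ]
    have : ∑ k, ((a.1 - c.θ i) k : ℂ) * ζ k =
        ∑ k, (a.1 k : ℂ) * ζ k - ∑ k, (c.θ i k : ℂ) * ζ k := by
      rw [← Finset.sum_sub_distrib]
      exact Finset.sum_congr rfl fun k _ => by push_cast [Pi.sub_apply]; ring
    rw [this, Complex.exp_sub]
    field_simp
  · rw [(h a).2 ha, mul_zero, hΩ.2]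
    by_contra! hcon
    exact ha ((c.mem_faceOf_sum_iff hθ ht a.2).mpr hcon)

theorem toFun_mem_torusImage {p : (Fin c.l → ℂ) × (Fin (n - c.l) → ℂ)} (hp : ∀ j, p.1 j ≠ 0) :
    c.toFun p ∈ torusImage A := by
  let z : Fin c.l ⊕ Fin (n - c.l) → ℂ :=
    Sum.elim (fun j => -Complex.log (p.1 j)) fun j => -p.2 j
  have hpz : p = chartPoint 0 z := by
    ext j
    · simp [chartPoint, z, Complex.exp_log (hp j)]
    · simp [chartPoint, z]
  let ζ : Fin n → ℂ := fun k => ∑ j, z j * (c.ξ j k : ℂ)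
  have hζ : ∀ a : Fin n → ℤ, ∑ k, (a k : ℂ) * ζ k = ∑ j, z j * (pairing a (c.ξ j) : ℝ) := by
    intro a
    simp only [ζ, pairing, Finset.mul_sum]
    rw [Finset.sum_comm]
    refine Finset.sum_congr rfl fun j _ => ?_
    push_cast
    rw [Finset.mul_sum]
    exact Finset.sum_congr rfl fun k _ => by ring
  have hver : ∀ (S : Finset (Fin n → ℤ)) (a : S),
      veronese S (fun k => Units.mk0 (Complex.exp (ζ k)) (Complex.exp_ne_zero _)) a =
        Complex.exp (∑ j, z j * (pairing a.1 (c.ξ j) : ℝ)) := fun S a => by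
    rw [← hζ, Complex.exp_sum]
    exact Finset.prod_congr rfl fun k _ => by rw [Complex.exp_int_mul, Units.val_mk0]
  refine ⟨fun k => Units.mk0 (Complex.exp (ζ k)) (Complex.exp_ne_zero _), fun i => ?_⟩
  obtain ⟨a₀, -⟩ : ∃ a, OmegaVec c.ξ (c.θ i) (A i) p a ≠ 0 := by
    by_contra! h
    exact c.ne_zero i p (funext h)
  refine ⟨fun h0 => ?_, ?_⟩
  · have := congrFun h0 a₀
    rw [hver] at this
    exact Complex.exp_ne_zero _ this
  · rw [toFun, Projectivization.mk_eq_mk_iff']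
    refine ⟨Complex.exp (-∑ j, z j * (pairing (c.θ i) (c.ξ j) : ℝ)), funext fun a => ?_⟩
    rw [Pi.smul_apply, smul_eq_mul, hver, ← Complex.exp_add, hpz, OmegaVec,
      (omegaCoord_chartPoint (c.exponent_nat i a.1 a.2) 0 z).1 (by simp)]
    congr 1
    rw [neg_add_eq_sub, ← Finset.sum_sub_distrib]
    exact Finset.sum_congr rfl fun j _ => by rw [pairing_sub_left]; push_cast; ring

/-- The values of a parameterization satisfy the equations of the torus image: on the dense set
where all `X j` are non-zero they lie in it. -/
theorem toFun_mem_toricVariety (p : (Fin c.l → ℂ) × (Fin (n - c.l) → ℂ)) :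
    c.toFun p ∈ toricVariety A := by
  intro F d hF hvan
  have hiff := fun p => hF.vanishesAt_iff (fun i => c.ne_zero i p)
  refine (hiff p).mpr ?_
  let q : ℝ → (Fin c.l → ℂ) × (Fin (n - c.l) → ℂ) := fun ε =>
    (fun j => if p.1 j = 0 then (ε : ℂ) else p.1 j, p.2)
  have hq : Continuous q := by
    refine Continuous.prodMk (continuous_pi fun j => ?_) continuous_const
    split_ifs
    exacts [Complex.continuous_ofReal, continuous_const]
  have hq0 : q 0 = p := by
    ext j
    · by_cases h : p.1 j = 0 <;> simp [q, h]
    · rfl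
  have hcont : Continuous fun ε =>
      MvPolynomial.eval (fun s : Σ i, A i => OmegaVec c.ξ (c.θ s.1) (A s.1) (q ε) s.2) F := by
    refine F.continuous_eval.comp (continuous_pi fun s => ?_)
    exact (continuous_apply s.2).comp ((c.continuous_omegaVec s.1).comp hq)
  have hlim := (hcont.tendsto 0).mono_left (nhdsWithin_le_nhds (s := Set.Ioi 0))
  rw [hq0] at hlim
  refine tendsto_nhds_unique hlim (tendsto_const_nhds.congr' ?_)
  filter_upwards [self_mem_nhdsWithin] with ε hε
  refine ((hiff (q ε)).mp (hvan _ (c.toFun_mem_torusImage fun j => ?_))).symm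
  by_cases h : p.1 j = 0
  · simpa [q, h] using (ne_of_gt hε : ε ≠ 0)
  · simp [q, h]

end Parameterization

end Image

/-! ### The parameterizations cover the toric variety -/

section Covering

variable {n : ℕ}

/-- Among finitely many numbers there is an initial set `Y` of small ones, bounded by
`C = (Φ ^ |Y| - 1) / (Φ - 1) Ψ`, after which there is a gap: all others exceed `Φ C + Ψ`. -/
theorem exists_gap {ι : Type*} (G : Finset ι) (α : ι → ℝ) {Φ Ψ : ℝ} (hΦ : 1 < Φ) (hΨ : 0 < Ψ) :
    ∃ Y ⊆ G, (∀ j ∈ Y, α j ≤ (Φ ^ Y.card - 1) / (Φ - 1) * Ψ) ∧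
      ∀ j ∈ G, j ∉ Y → Φ * ((Φ ^ Y.card - 1) / (Φ - 1) * Ψ) + Ψ < α j := by
  classical
  have hΦ' : Φ - 1 ≠ 0 := by linarith
  have hC : ∀ m : ℕ, (Φ ^ (m + 1) - 1) / (Φ - 1) * Ψ =
      Φ * ((Φ ^ m - 1) / (Φ - 1) * Ψ) + Ψ := fun m => by
    field_simp
    ring
  -- a largest set `Y` with the required bound has a gap behind it
  let P : Finset (Finset ι) :=
    G.powerset.filter fun Y => ∀ j ∈ Y, α j ≤ (Φ ^ Y.card - 1) / (Φ - 1) * Ψ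
  obtain ⟨Y, hY, hmax⟩ := P.exists_max_image Finset.card ⟨∅, by simp [P]⟩
  obtain ⟨hYG, hbd⟩ : Y ⊆ G ∧ ∀ j ∈ Y, α j ≤ (Φ ^ Y.card - 1) / (Φ - 1) * Ψ := by
    simpa [P] using hY
  refine ⟨Y, hYG, hbd, fun j hj hjY => ?_⟩
  by_contra! hle
  have hcard := Finset.card_insert_of_notMem hjY
  have hins : insert j Y ∈ P := by
    simp only [P, Finset.mem_filter, Finset.mem_powerset]
    refine ⟨Finset.insert_subset hj hYG, fun k hk => ?_⟩
    rw [hcard, hC]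
    rcases Finset.mem_insert.mp hk with rfl | hk
    · exact hle
    · have h0 : 0 ≤ (Φ ^ Y.card - 1) / (Φ - 1) * Ψ :=
        mul_nonneg (div_nonneg (by linarith [one_le_pow₀ hΦ.le (n := Y.card)]) (by linarith)) hΨ.le
      nlinarith [hbd k hk]
  have := hmax _ hins
  omega

theorem exists_coords {ι : Type*} [Fintype ι] {ξ : ι → Fin n → ℝ} (hξ : LinearIndependent ℝ ξ)
    (hcard : Fintype.card ι = n) (x : Fin n → ℝ) : ∃ γ : ι → ℝ, x = ∑ j, γ j • ξ j := by
  let b := basisOfLinearIndependentOfCardEqFinrank' ξ hξ (by simpa using hcard)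
  refine ⟨b.repr x, ?_⟩
  conv_lhs => rw [← b.sum_repr x]
  simp [b]

/-- Real coordinates of the real and the imaginary part of `ζ` give complex coordinates. -/
theorem sum_intCast_mul_eq {ι : Type*} [Fintype ι] {ξ : ι → Fin n → ℝ} {ζ : Fin n → ℂ}
    {α γ : ι → ℝ} (hre : (fun k => (ζ k).re) = ∑ j, α j • ξ j)
    (him : (fun k => (ζ k).im) = ∑ j, γ j • ξ j) (a : Fin n → ℤ) :
    ∑ k, (a k : ℂ) * ζ k = ∑ j, (⟨α j, γ j⟩ : ℂ) * (pairing a (ξ j) : ℝ) := by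
  have h1 := congrArg (pairing a) hre
  have h2 := congrArg (pairing a) him
  rw [pairing_sum_smul] at h1 h2
  apply Complex.ext
  · simpa [pairing] using h1
  · simpa [pairing] using h2

variable {A : Fin n → Finset (Fin n → ℤ)}

/-- Every point of the toric variety lies in the image of the domain of a parameterization whose
shifts `θ i` are points of `A i`. The `n - l` variables `y` are the coordinates of the torus point along the
rays that come before the gap. -/
theorem exists_parameterization_of_mem_toricVariety (hA : ∀ i, (A i).Nonempty)
    (hnd : IsNondegenerate A) {v : MultiProj A} (hv : v ∈ toricVariety A) {Φ Ψ ε : ℝ}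
    (hΦ : 1 < Φ) (hΨ : 0 < Ψ) (hε : 0 < ε) :
    ∃ c : Parameterization A, (∀ i, c.θ i ∈ A i) ∧ ∃ p ∈ c.domain Φ Ψ ε, c.toFun p = v := by
  classical
  obtain ⟨η, ζ, hηζ⟩ := exists_face_torus_of_mem_toricVariety hv
  obtain ⟨ξ, hli, hmin, ⟨w, hw⟩, α, β, hα, hβ, hlex⟩ :=
    exists_basis_lex_decomposition hA hnd (fun k => (ζ k).re) η
  obtain ⟨γ, hγ⟩ := exists_coords hli (Fintype.card_fin n) (fun k => (ζ k).im)
  obtain ⟨Y, hYG, hYle, hYgt⟩ := exists_gap (Finset.univ.filter fun j => β j = 0) α hΦ hΨ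
  have hYn : Y.card ≤ n := by simpa using Y.card_le_univ
  set l := n - Y.card with hl
  have hnl : n - l = Y.card := by omega
  let e : Fin l ⊕ Fin (n - l) ≃ Fin n := finSumEquivOfFinset (s := Yᶜ)
    (by rw [Finset.card_compl, Fintype.card_fin]) (by rw [compl_compl, hnl])
  have hel : ∀ j, e (Sum.inl j) ∉ Y := fun j => by
    have : e (Sum.inl j) ∈ Yᶜ := by simp [e]
    exact Finset.mem_compl.mp this
  have her : ∀ j, e (Sum.inr j) ∈ Y := fun j => by
    have : e (Sum.inr j) ∈ Yᶜᶜ := by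
      simp only [e, finSumEquivOfFinset_inr]
      exact Finset.orderEmbOfFin_mem _ _ _
    rwa [compl_compl] at this
  have hβr : ∀ j, β (e (Sum.inr j)) = 0 := fun j => (Finset.mem_filter.mp (hYG (her j))).2
  choose θ hθ using fun i => faceOf_nonempty (hA i) w
  have hdim : coneDim (carrierCone A w) = n := by
    have htop : Submodule.span ℝ (carrierCone A w) = ⊤ := by
      refine eq_top_iff.mpr ?_
      rw [← hli.span_eq_top_of_card_eq_finrank' (by simp)]
      exact Submodule.span_mono (Set.range_subset_iff.mpr hw)
    rw [coneDim, htop, finrank_top, Module.finrank_fintype_fun_eq_card, Fintype.card_fin]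
  let c : Parameterization A :=
    { l := l
      l_le := Nat.sub_le _ _
      ξ := ξ ∘ e
      θ := θ
      minimal_ray := fun j => hmin _
      linearIndependent := hli.comp e e.injective
      exists_cone := ⟨carrierCone A w, (isFanCone_iff hA).mpr ⟨w, rfl⟩, hdim, fun j => hw _⟩
      exponent_nat := fun i a ha j => by
        obtain ⟨k, hk⟩ := (hmin (e j)).1 (a - θ i) (sub_mem_latticeOf ha (hθ i).1)
        have h1 := (hw (e j) i (hθ i)).2 a ha
        have h2 : (k : ℝ) ≤ 0 := by rw [← hk, pairing_sub_left]; linarith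
        refine ⟨(-k).toNat, ?_⟩
        have h3 : ((-k).toNat : ℤ) = -k := Int.toNat_of_nonneg (by
          have : k ≤ 0 := by exact_mod_cast h2
          omega)
        rw [pairing_neg, Function.comp_apply, hk]
        exact_mod_cast h3.symm
      exponent_zero := fun i j => ⟨θ i, (hθ i).1, by rw [sub_self, zero_pairing]⟩
      ne_zero := fun i p h => by
        have := congrFun h ⟨θ i, (hθ i).1⟩
        simp [OmegaVec, OmegaCoord, zero_pairing] at this }
  have hθA : ∀ i, c.θ i ∈ A i := fun i => (hθ i).1
  let z : Fin l ⊕ Fin (n - l) → ℂ := fun j => ⟨α (e j), γ (e j)⟩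
  let t : Fin l → ℝ := fun j => β (e (Sum.inl j))
  have hη : η = ∑ j, t j • c.ξ (Sum.inl j) := by
    rw [hβ, ← Equiv.sum_comp e, Fintype.sum_sum_type]
    simp only [hβr, zero_smul, Finset.sum_const_zero, add_zero]
    rfl
  have hz : ∀ a : Fin n → ℤ, ∑ k, (a k : ℂ) * ζ k = ∑ j, z j * (pairing a (c.ξ j) : ℝ) :=
    sum_intCast_mul_eq (hα.trans (Equiv.sum_comp e fun j => α j • ξ j).symm)
      (hγ.trans (Equiv.sum_comp e fun j => γ j • ξ j).symm)
  have hval := c.toFun_chartPoint hθA (t := t) (fun j => (hlex _).1) hz (hη ▸ hηζ)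
  refine ⟨c, hθA, chartPoint t z, ⟨fun j => ?_, fun j => ?_⟩, hval⟩
  · have hnorm : ‖(fun k => ((chartPoint t z).2 k).re : Fin (n - l) → ℝ)‖ ≤
        (Φ ^ Y.card - 1) / (Φ - 1) * Ψ := by
      have h0 : 0 ≤ (Φ ^ Y.card - 1) / (Φ - 1) * Ψ :=
        mul_nonneg (div_nonneg (by linarith [one_le_pow₀ hΦ.le (n := Y.card)]) (by linarith)) hΨ.le
      refine (pi_norm_le_iff_of_nonneg h0).mpr fun k => ?_
      simp only [chartPoint, Complex.neg_re, norm_neg, Real.norm_eq_abs, z]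
      rw [abs_of_nonneg ((hlex _).2 (hβr k))]
      exact hYle _ (her k)
    change ‖(chartPoint t z).1 j‖ < _
    by_cases ht : t j = 0
    · simp only [chartPoint, if_pos ht, Complex.norm_exp, Complex.neg_re]
      refine Real.exp_lt_exp.mpr ?_
      have := hYgt (e (Sum.inl j)) (by simpa using ht) (hel j)
      have h2 := mul_le_mul_of_nonneg_left hnorm (zero_le_one.trans hΦ.le)
      change -α (e (Sum.inl j)) < -Φ * ‖(fun k => ((chartPoint t z).2 k).re : Fin (n - l) → ℝ)‖ - Ψ
      linarith
    · simp only [chartPoint, if_neg ht, norm_zero]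
      exact Real.exp_pos _
  · have h1 := hYle _ (her j)
    have h2 := (hlex _).2 (hβr j)
    change -((Φ ^ (n - l) - 1) / (Φ - 1)) * Ψ - ε < -α (e (Sum.inr j)) ∧ -α (e (Sum.inr j)) < ε
    rw [show Φ ^ (n - l) = Φ ^ Y.card by rw [hnl]]
    constructor <;> linarith

end Covering

/-! ### Ratios of coordinates on projective space -/

section Ratio

variable {ι : Type}

theorem isOpen_setOf_rep {P : (ι → ℂ) → Prop} (hP : IsOpen {w | P w})
    (hsmul : ∀ (r : ℂˣ) w, P (r • w) ↔ P w) : IsOpen {u : ℙ ℂ (ι → ℂ) | P u.rep} := by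
  change IsOpen ((fun w : {w : ι → ℂ // w ≠ 0} => Projectivization.mk ℂ w.1 w.2) ⁻¹'
    {u : ℙ ℂ (ι → ℂ) | P u.rep})
  have : (fun w : {w : ι → ℂ // w ≠ 0} => Projectivization.mk ℂ w.1 w.2) ⁻¹'
      {u : ℙ ℂ (ι → ℂ) | P u.rep} = Subtype.val ⁻¹' {w | P w} := by
    ext w
    obtain ⟨r, hr⟩ := Projectivization.exists_smul_eq_mk_rep ℂ w.1 w.2
    change P _ ↔ P _
    rw [← hr, hsmul]
  rw [this]
  exact hP.preimage continuous_subtype_val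

theorem tendsto_norm_rep_div {v : ℙ ℂ (ι → ℂ)} (a : ι) {b : ι} (hb : v.rep b ≠ 0) :
    Filter.Tendsto (fun u : ℙ ℂ (ι → ℂ) => ‖u.rep a‖ / ‖u.rep b‖) (𝓝 v)
      (𝓝 (‖v.rep a‖ / ‖v.rep b‖)) := by
  have hpos : 0 < ‖v.rep b‖ := norm_pos_iff.mpr hb
  have hc : ∀ a, Continuous fun w : ι → ℂ => ‖w a‖ := fun a => (continuous_apply a).norm
  have hs : ∀ (r : ℂˣ) (w : ι → ℂ) a, ‖(r • w) a‖ = ‖(r : ℂ)‖ * ‖w a‖ := fun r w a => by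
    rw [Pi.smul_apply, Units.smul_def, smul_eq_mul, norm_mul]
  have hr : ∀ r : ℂˣ, 0 < ‖(r : ℂ)‖ := fun r => norm_pos_iff.mpr r.ne_zero
  have hev : ∀ᶠ u : ℙ ℂ (ι → ℂ) in 𝓝 v, 0 < ‖u.rep b‖ :=
    (isOpen_setOf_rep (P := fun w => 0 < ‖w b‖) (isOpen_lt continuous_const (hc b)) fun r w => by
      rw [hs, mul_pos_iff_of_pos_left (hr r)]).mem_nhds hpos
  refine tendsto_order.mpr ⟨fun m hm => ?_, fun m hm => ?_⟩
  · have h1 : ∀ᶠ u : ℙ ℂ (ι → ℂ) in 𝓝 v, m * ‖u.rep b‖ < ‖u.rep a‖ :=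
      (isOpen_setOf_rep (P := fun w => m * ‖w b‖ < ‖w a‖)
        (isOpen_lt (continuous_const.mul (hc b)) (hc a)) fun r w => by
          rw [hs, hs, mul_left_comm, mul_lt_mul_iff_right₀ (hr r)]).mem_nhds
        ((lt_div_iff₀ hpos).mp hm)
    filter_upwards [hev, h1] with u h0 h1 using (lt_div_iff₀ h0).mpr h1
  · have h1 : ∀ᶠ u : ℙ ℂ (ι → ℂ) in 𝓝 v, ‖u.rep a‖ < m * ‖u.rep b‖ :=
      (isOpen_setOf_rep (P := fun w => ‖w a‖ < m * ‖w b‖)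
        (isOpen_lt (hc a) (continuous_const.mul (hc b))) fun r w => by
          rw [hs, hs, mul_left_comm, mul_lt_mul_iff_right₀ (hr r)]).mem_nhds
        ((div_lt_iff₀ hpos).mp hm)
    filter_upwards [hev, h1] with u h0 h1 using (div_lt_iff₀ h0).mpr h1

end Ratio

/-! ### Images of parameterizations as neighborhoods -/

namespace Parameterization

variable {n : ℕ} {A : Fin n → Finset (Fin n → ℤ)} (c : Parameterization A)

theorem isOpen_domain (Φ Ψ ε : ℝ) : IsOpen (c.domain Φ Ψ ε) := by
  simp only [domain, Set.ofPred_and, Set.ofPred_forall]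
  refine IsOpen.inter (isOpen_iInter_of_finite fun j => isOpen_lt (by fun_prop) ?_)
    (isOpen_iInter_of_finite fun j => IsOpen.inter
      (isOpen_lt continuous_const (by fun_prop)) (isOpen_lt (by fun_prop) continuous_const))
  refine Real.continuous_exp.comp (Continuous.sub (continuous_const.mul ?_) continuous_const)
  exact continuous_norm.comp (by fun_prop)

theorem coords_unique {s : Fin c.l ⊕ Fin (n - c.l) → ℝ} {t : Fin c.l → ℝ}
    (h : ∑ j, s j • c.ξ j = ∑ j, t j • c.ξ (Sum.inl j)) :
    (∀ j, s (Sum.inl j) = t j) ∧ ∀ j, s (Sum.inr j) = 0 := by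
  have h1 : ∑ j, s j • c.ξ j = ∑ j, (Sum.elim t 0 : _ → ℝ) j • c.ξ j := by
    rw [h, Fintype.sum_sum_type]
    simp
  have h2 := fun j => c.linearIndependent.eq_coords_of_eq h1 j
  exact ⟨fun j => h2 (Sum.inl j), fun j => h2 (Sum.inr j)⟩

/-- The sum of the rays whose coordinate vanishes at `p`: a vector in the relative interior of
`c.vanishingCone p`. -/
noncomputable def vanishingSum (p : (Fin c.l → ℂ) × (Fin (n - c.l) → ℂ)) : Fin n → ℝ :=
  ∑ j, (if p.1 j = 0 then (1 : ℝ) else 0) • c.ξ (Sum.inl j)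

variable {c} {p : (Fin c.l → ℂ) × (Fin (n - c.l) → ℂ)}

theorem mem_faceOf_vanishingSum_iff (hθ : ∀ i, c.θ i ∈ A i) {i : Fin n} {a} (ha : a ∈ A i) :
    a ∈ faceOf (A i) (c.vanishingSum p) ↔
      ∀ j, p.1 j = 0 → pairing (a - c.θ i) (c.ξ (Sum.inl j)) = 0 := by
  rw [vanishingSum, c.mem_faceOf_sum_iff hθ (fun j => by split_ifs <;> norm_num) ha]
  simp

theorem vanishingCone_eq (hA : ∀ i, (A i).Nonempty) (hθ : ∀ i, c.θ i ∈ A i)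
    (hcone : IsFanCone A (c.vanishingCone p)) :
    c.vanishingCone p = carrierCone A (c.vanishingSum p) := by
  obtain ⟨w, hw⟩ := (isFanCone_iff hA).mp hcone
  have h1 : c.vanishingSum p ∈ c.vanishingCone p :=
    ⟨fun j => if p.1 j = 0 then 1 else 0, fun j => by dsimp only; split_ifs <;> simp_all, rfl⟩
  have h2 : w ∈ carrierCone A (c.vanishingSum p) := by
    obtain ⟨t, ht, rfl⟩ : w ∈ c.vanishingCone p := hw ▸ self_mem_carrierCone
    intro i a ha
    have haA := ha.1
    rw [mem_faceOf_vanishingSum_iff hθ haA] at ha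
    refine (c.mem_faceOf_sum_iff hθ (fun j => (ht j).1) haA).mpr fun j hj => ha j ?_
    by_contra h
    exact hj ((ht j).2 h)
  rw [hw] at h1 ⊢
  exact subset_antisymm (carrierCone_subset h2) (carrierCone_subset h1)

/-- If the vanishing rays span a cone of the fan, its linear span is cut out by the differences of
points in its faces. -/
theorem coords_eq_zero (hA : ∀ i, (A i).Nonempty)
    (hcone : c.vanishingCone p = carrierCone A (c.vanishingSum p))
    {s : Fin c.l ⊕ Fin (n - c.l) → ℝ}
    (hs : ∑ j, s j • c.ξ j ∈ carrierSpan A (c.vanishingSum p)) :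
    (∀ j, p.1 j ≠ 0 → s (Sum.inl j) = 0) ∧ ∀ j, s (Sum.inr j) = 0 := by
  obtain ⟨ε, hε, hmem⟩ := exists_add_smul_mem_carrierCone hA hs
  rw [← hcone] at hmem
  obtain ⟨t, ht, heq⟩ := hmem
  have h1 : ∑ j, (ε * s j) • c.ξ j =
      ∑ j, (t j - if p.1 j = 0 then 1 else 0) • c.ξ (Sum.inl j) := by
    simp only [mul_smul, ← Finset.smul_sum, sub_smul, Finset.sum_sub_distrib]
    rw [← heq, vanishingSum, add_sub_cancel_left]
  obtain ⟨h2, h3⟩ := c.coords_unique h1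
  refine ⟨fun j hj => ?_, fun j => ?_⟩
  · have := h2 j
    rw [(ht j).2 hj, if_neg hj, sub_zero] at this
    exact (mul_eq_zero.mp this).resolve_left hε.ne'
  · exact (mul_eq_zero.mp (h3 j)).resolve_left hε.ne'

/-- Each vanishing ray is detected by a coordinate that does not involve the others: leaving out
one ray of a simplicial cone gives a proper face. -/
theorem exists_coordinate_of_vanishing (hA : ∀ i, (A i).Nonempty) (hθ : ∀ i, c.θ i ∈ A i)
    (hcone : c.vanishingCone p = carrierCone A (c.vanishingSum p)) {j : Fin c.l}
    (hj : p.1 j = 0) :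
    ∃ i, ∃ a ∈ A i, pairing (a - c.θ i) (c.ξ (Sum.inl j)) < 0 ∧
      ∀ k, k ≠ j → p.1 k = 0 → pairing (a - c.θ i) (c.ξ (Sum.inl k)) = 0 := by
  classical
  by_contra! hcon
  let t₁ : Fin c.l → ℝ := fun k => if p.1 k = 0 ∧ k ≠ j then 1 else 0
  have ht₁ : ∀ k, 0 ≤ t₁ k := fun k => by simp only [t₁]; split_ifs <;> norm_num
  set x₁ : Fin n → ℝ := ∑ k, t₁ k • c.ξ (Sum.inl k) with hx₁
  have hface : ∀ i, faceOf (A i) x₁ = faceOf (A i) (c.vanishingSum p) := by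
    intro i
    ext a
    by_cases ha : a ∈ A i
    · rw [c.mem_faceOf_sum_iff hθ ht₁ ha, mem_faceOf_vanishingSum_iff hθ ha]
      refine ⟨fun h k hk => ?_, fun h k hk => h k ?_⟩
      · by_cases hkj : k = j
        · subst hkj
          refine le_antisymm (c.pairing_sub_nonpos hθ ha _) (not_lt.mp fun hlt => ?_)
          obtain ⟨m, hmj, hm, hne⟩ := hcon i a ha hlt
          exact hne (h m (by simp [t₁, hmj, hm]))
        · exact h k (by simp [t₁, hk, hkj])
      · by_contra h0
        simp [t₁, h0] at hk
    · exact ⟨fun h => absurd h.1 ha, fun h => absurd h.1 ha⟩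
  have hcone₁ : carrierCone A x₁ = c.vanishingCone p := by
    rw [hcone]
    simp only [carrierCone, hface]
  have hmem : -c.ξ (Sum.inl j) ∈ carrierSpan A x₁ := by
    refine neg_mem (mem_carrierSpan_of_mem_carrierCone ?_)
    rw [hcone₁]
    refine ⟨Pi.single j 1, fun k => ?_, ?_⟩
    · by_cases hk : k = j
      · subst hk; simp [hj]
      · simp [hk]
    · rw [Finset.sum_eq_single j (fun k _ hk => by simp [hk]) (by simp)]
      simp
  obtain ⟨ε, hε, h⟩ := exists_add_smul_mem_carrierCone hA hmem
  rw [hcone₁] at h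
  obtain ⟨t, ht, heq⟩ := h
  have h1 : ∑ k, (Sum.elim (fun k => t₁ k - (Pi.single j ε : Fin c.l → ℝ) k) 0 : _ → ℝ) k • c.ξ k =
      ∑ k, t k • c.ξ (Sum.inl k) := by
    rw [← heq, hx₁, Fintype.sum_sum_type]
    simp only [Sum.elim_inl, Sum.elim_inr, Pi.zero_apply, zero_smul, Finset.sum_const_zero,
      add_zero, sub_smul, Finset.sum_sub_distrib, smul_neg]
    rw [Finset.sum_eq_single (f := fun k => (Pi.single j ε : Fin c.l → ℝ) k • c.ξ (Sum.inl k)) j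
      (fun k _ hk => by simp [hk]) (by simp)]
    simp [sub_eq_add_neg]
  have h2 := (c.coords_unique h1).1 j
  have h3 := (ht j).1
  simp only [Sum.elim_inl, t₁, ne_eq, not_true_eq_false, and_false, if_false, Pi.single_eq_same]
    at h2
  linarith

/-- The absolute value of a coordinate relative to the coordinate of the shift. -/
noncomputable def normRatio (hθ : ∀ i, c.θ i ∈ A i) (v : MultiProj A) (i : Fin n) (a : A i) : ℝ :=
  ‖(v i).rep a‖ / ‖(v i).rep ⟨c.θ i, hθ i⟩‖

theorem omegaVec_shift (hθ : ∀ i, c.θ i ∈ A i) (i : Fin n) :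
    OmegaVec c.ξ (c.θ i) (A i) p ⟨c.θ i, hθ i⟩ = 1 := by
  simp [OmegaVec, OmegaCoord, zero_pairing]

theorem rep_toFun_shift_ne_zero (hθ : ∀ i, c.θ i ∈ A i) (i : Fin n) :
    (c.toFun p i).rep ⟨c.θ i, hθ i⟩ ≠ 0 := by
  obtain ⟨r, hr⟩ := Projectivization.exists_smul_eq_mk_rep ℂ _ (c.ne_zero i p)
  rw [toFun, ← hr, Pi.smul_apply, omegaVec_shift]
  simp [Units.smul_def]

theorem normRatio_toFun (hθ : ∀ i, c.θ i ∈ A i) (i : Fin n) (a : A i) :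
    normRatio hθ (c.toFun p) i a = ‖OmegaVec c.ξ (c.θ i) (A i) p a‖ := by
  obtain ⟨r, hr⟩ := Projectivization.exists_smul_eq_mk_rep ℂ _ (c.ne_zero i p)
  rw [normRatio, toFun, ← hr, Pi.smul_apply, Pi.smul_apply, omegaVec_shift, Units.smul_def,
    Units.smul_def, smul_eq_mul, smul_eq_mul, norm_mul, norm_mul, norm_one, mul_one,
    mul_div_cancel_left₀ _ (norm_ne_zero_iff.mpr r.ne_zero)]

theorem normRatio_chartPoint (hθ : ∀ i, c.θ i ∈ A i) (t : Fin c.l → ℝ)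
    (z : Fin c.l ⊕ Fin (n - c.l) → ℂ) (i : Fin n) (a : A i) :
    ((∀ j, t j ≠ 0 → pairing (a.1 - c.θ i) (c.ξ (Sum.inl j)) = 0) →
      normRatio hθ (c.toFun (chartPoint t z)) i a =
        Real.exp (∑ j, (z j).re * pairing (a.1 - c.θ i) (c.ξ j))) ∧
    ((∃ j, t j ≠ 0 ∧ pairing (a.1 - c.θ i) (c.ξ (Sum.inl j)) ≠ 0) →
      normRatio hθ (c.toFun (chartPoint t z)) i a = 0) := by
  have h := omegaCoord_chartPoint (c.exponent_nat i a.1 a.2) t z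
  rw [normRatio_toFun, OmegaVec]
  refine ⟨fun h0 => ?_, fun h0 => by rw [h.2 h0, norm_zero]⟩
  rw [h.1 h0, Complex.norm_exp]
  congr 1
  simp

theorem tendsto_normRatio (hθ : ∀ i, c.θ i ∈ A i) (i : Fin n) (a : A i) :
    Filter.Tendsto (fun v => normRatio hθ v i a) (𝓝 (c.toFun p))
      (𝓝 (normRatio hθ (c.toFun p) i a)) :=
  (tendsto_norm_rep_div a (rep_toFun_shift_ne_zero hθ i)).comp ((continuous_apply i).tendsto _)

theorem eq_chartPoint (p : (Fin c.l → ℂ) × (Fin (n - c.l) → ℂ)) :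
    p = chartPoint (fun j => if p.1 j = 0 then 1 else 0)
      (Sum.elim (fun j => -Complex.log (p.1 j)) fun j => -p.2 j) := by
  ext j
  · by_cases h : p.1 j = 0 <;> simp [chartPoint, h, Complex.exp_log]
  · simp [chartPoint]

/-- A point of the toric variety with at least the non-vanishing coordinates of the cone
`c.vanishingCone p` is a value of the parameterization: its direction lies in that cone. -/
theorem exists_chartPoint (hθ : ∀ i, c.θ i ∈ A i)
    (hcone : c.vanishingCone p = carrierCone A (c.vanishingSum p)) {v : MultiProj A}
    (hv : v ∈ toricVariety A)
    (hsupp : ∀ i, ∀ a : A i, a.1 ∈ faceOf (A i) (c.vanishingSum p) → (v i).rep a ≠ 0) :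
    ∃ (t : Fin c.l → ℝ) (z : Fin c.l ⊕ Fin (n - c.l) → ℂ),
      (∀ j, p.1 j ≠ 0 → t j = 0) ∧ c.toFun (chartPoint t z) = v := by
  obtain ⟨η, ζ, hηζ⟩ := exists_face_torus_of_mem_toricVariety hv
  have hη : η ∈ c.vanishingCone p := by
    rw [hcone]
    intro i a ha
    obtain ⟨r, -, h⟩ := hηζ i
    by_contra hna
    exact hsupp i ⟨a, ha.1⟩ ha ((h ⟨a, ha.1⟩).2 hna)
  obtain ⟨t, ht, rfl⟩ := hη
  have hcard : Fintype.card (Fin c.l ⊕ Fin (n - c.l)) = n := by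
    have := c.l_le
    simp only [Fintype.card_sum, Fintype.card_fin]
    omega
  obtain ⟨α, hα⟩ := exists_coords c.linearIndependent hcard fun k => (ζ k).re
  obtain ⟨γ, hγ⟩ := exists_coords c.linearIndependent hcard fun k => (ζ k).im
  exact ⟨t, fun j => ⟨α j, γ j⟩, fun j => (ht j).2,
    c.toFun_chartPoint hθ (fun j => (ht j).1) (sum_intCast_mul_eq hα hγ) hηζ⟩

/-- The logarithmic coordinates along the rays that do not vanish at `p` are linear functions of
the logarithms of the non-vanishing coordinates of the toric variety. -/
theorem exists_linear_coord (hA : ∀ i, (A i).Nonempty) (hθ : ∀ i, c.θ i ∈ A i)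
    (hcone : c.vanishingCone p = carrierCone A (c.vanishingSum p))
    {k : Fin c.l ⊕ Fin (n - c.l)} (hk : ∀ j, k = Sum.inl j → p.1 j ≠ 0) :
    ∃ φ : ({s : Σ i, A i // s.2.1 ∈ faceOf (A s.1) (c.vanishingSum p)} → ℝ) →ₗ[ℝ] ℝ,
      ∀ s : Fin c.l ⊕ Fin (n - c.l) → ℝ,
        φ (fun q => ∑ j, s j * pairing (q.1.2.1 - c.θ q.1.1) (c.ξ j)) = s k := by
  let T : (Fin c.l ⊕ Fin (n - c.l) → ℝ) →ₗ[ℝ]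
      ({s : Σ i, A i // s.2.1 ∈ faceOf (A s.1) (c.vanishingSum p)} → ℝ) :=
    { toFun := fun s q => ∑ j, s j * pairing (q.1.2.1 - c.θ q.1.1) (c.ξ j)
      map_add' := fun s s' => funext fun q => by
        simp [add_mul, Finset.sum_add_distrib]
      map_smul' := fun r s => funext fun q => by
        simp [-Fintype.sum_sum_type, Finset.mul_sum, mul_assoc] }
  have hker : (LinearMap.proj k : (Fin c.l ⊕ Fin (n - c.l) → ℝ) →ₗ[ℝ] ℝ) ∈
      T.ker.dualAnnihilator := by
    rw [Submodule.mem_dualAnnihilator]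
    intro s hs
    have hθmem : ∀ i, c.θ i ∈ faceOf (A i) (c.vanishingSum p) := fun i =>
      (mem_faceOf_vanishingSum_iff hθ (hθ i)).mpr fun j _ => by rw [sub_self, zero_pairing]
    have key : ∀ i, ∀ a ∈ faceOf (A i) (c.vanishingSum p),
        pairing a (∑ j, s j • c.ξ j) = pairing (c.θ i) (∑ j, s j • c.ξ j) := by
      intro i a ha
      have h1 : ∑ j, s j * pairing (a - c.θ i) (c.ξ j) = 0 :=
        congrFun (LinearMap.mem_ker.mp hs) ⟨⟨i, a, ha.1⟩, ha⟩
      rw [← pairing_sum_smul, pairing_sub_left] at h1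
      linarith
    have h0 := coords_eq_zero hA hcone (s := s) fun i a ha b hb => by
      rw [key i a ha, key i b hb]
    rcases k with j | j
    · exact h0.1 j (hk j rfl)
    · exact h0.2 j
  rw [← LinearMap.range_dualMap_eq_dualAnnihilator_ker] at hker
  obtain ⟨φ, hφ⟩ := hker
  exact ⟨φ, fun s => LinearMap.congr_fun hφ s⟩

/-- Near a point whose vanishing rays span a cone of the fan, all points of the toric variety are
values of the parameterization, at points whose coordinates have nearby absolute values `|X j|`
and real parts `Re (y j)`; arguments and imaginary parts play no role for the domain. -/
theorem image_domain_mem_nhdsWithin (hA : ∀ i, (A i).Nonempty) (hθ : ∀ i, c.θ i ∈ A i)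
    {Φ Ψ ε : ℝ} (hp : p ∈ c.domain Φ Ψ ε) (hfan : IsFanCone A (c.vanishingCone p)) :
    c.toFun '' c.domain Φ Ψ ε ∈ 𝓝[toricVariety A] (c.toFun p) := by
  classical
  have hcone := vanishingCone_eq hA hθ hfan
  set F := 𝓝[toricVariety A] (c.toFun p)
  have hR : ∀ i (a : A i), Filter.Tendsto (fun v => normRatio hθ v i a) F
      (𝓝 (normRatio hθ (c.toFun p) i a)) := fun i a =>
    (tendsto_normRatio hθ i a).mono_left nhdsWithin_le_nhds
  -- the logarithmic coordinates of `p`, with the junk value `log 0 = 0` along vanishing rays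
  let z₀ : Fin c.l ⊕ Fin (n - c.l) → ℂ :=
    Sum.elim (fun j => -Complex.log (p.1 j)) fun j => -p.2 j
  have hp₀ : p = chartPoint (fun j => if p.1 j = 0 then 1 else 0) z₀ := eq_chartPoint p
  have hRp : ∀ i (a : A i), a.1 ∈ faceOf (A i) (c.vanishingSum p) →
      normRatio hθ (c.toFun p) i a =
        Real.exp (∑ j, (z₀ j).re * pairing (a.1 - c.θ i) (c.ξ j)) := by
    intro i a ha
    rw [mem_faceOf_vanishingSum_iff hθ a.2] at ha
    conv_lhs => rw [hp₀]
    exact (normRatio_chartPoint hθ _ z₀ i a).1 fun j hj => ha j (by simpa using hj)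
  have hRp0 : ∀ i (a : A i), a.1 ∉ faceOf (A i) (c.vanishingSum p) →
      normRatio hθ (c.toFun p) i a = 0 := by
    intro i a ha
    rw [mem_faceOf_vanishingSum_iff hθ a.2] at ha
    push Not at ha
    obtain ⟨j, hj, hne⟩ := ha
    conv_lhs => rw [hp₀]
    exact (normRatio_chartPoint hθ _ z₀ i a).2 ⟨j, by simp [hj], hne⟩
  -- nearby points have the non-vanishing coordinates of `c.toFun p`, hence are values of `c`
  have hsupp : ∀ᶠ v in F, ∀ i, ∀ a : A i,
      a.1 ∈ faceOf (A i) (c.vanishingSum p) → (v i).rep a ≠ 0 := by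
    refine Filter.eventually_all.mpr fun i => Filter.eventually_all.mpr fun a => ?_
    by_cases ha : a.1 ∈ faceOf (A i) (c.vanishingSum p)
    · have h0 : 0 < normRatio hθ (c.toFun p) i a := by rw [hRp i a ha]; exact Real.exp_pos _
      filter_upwards [(hR i a).eventually_const_lt h0] with v hv _ h
      simp [normRatio, h] at hv
    · exact Filter.Eventually.of_forall fun v h => absurd h ha
  have hmemV : ∀ᶠ v in F, v ∈ toricVariety A := self_mem_nhdsWithin
  have hex : ∀ v : MultiProj A, ∃ (t : Fin c.l → ℝ) (z : Fin c.l ⊕ Fin (n - c.l) → ℂ),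
      v ∈ toricVariety A →
      (∀ i, ∀ a : A i, a.1 ∈ faceOf (A i) (c.vanishingSum p) → (v i).rep a ≠ 0) →
      (∀ j, p.1 j ≠ 0 → t j = 0) ∧ c.toFun (chartPoint t z) = v := by
    intro v
    by_cases h : v ∈ toricVariety A ∧
        ∀ i, ∀ a : A i, a.1 ∈ faceOf (A i) (c.vanishingSum p) → (v i).rep a ≠ 0
    · obtain ⟨t, z, h'⟩ := exists_chartPoint hθ hcone h.1 h.2
      exact ⟨t, z, fun _ _ => h'⟩
    · exact ⟨0, 0, fun h1 h2 => absurd ⟨h1, h2⟩ h⟩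
  choose t z htz using hex
  have hev : ∀ᶠ v in F, (∀ j, p.1 j ≠ 0 → t v j = 0) ∧ c.toFun (chartPoint (t v) (z v)) = v := by
    filter_upwards [hmemV, hsupp] with v h1 h2 using htz v h1 h2
  have hRv : ∀ i (a : A i), ∀ᶠ v in F,
      (∀ j, t v j ≠ 0 → pairing (a.1 - c.θ i) (c.ξ (Sum.inl j)) = 0) →
      normRatio hθ v i a =
        Real.exp (∑ j, (z v j).re * pairing (a.1 - c.θ i) (c.ξ j)) := by
    intro i a
    filter_upwards [hev] with v hv h0
    conv_lhs => rw [← hv.2]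
    exact (normRatio_chartPoint hθ (t v) (z v) i a).1 h0
  -- convergence of the logarithmic coordinates along non-vanishing rays
  have hcoord : ∀ k : Fin c.l ⊕ Fin (n - c.l), (∀ j, k = Sum.inl j → p.1 j ≠ 0) →
      Filter.Tendsto (fun v => (z v k).re) F (𝓝 (z₀ k).re) := by
    intro k hk
    obtain ⟨φ, hφ⟩ := exists_linear_coord hA hθ hcone hk
    have hφc : Continuous φ := φ.continuous_of_finiteDimensional
    rw [← hφ fun j => (z₀ j).re]
    rw [funext fun v => (hφ fun j => (z v j).re).symm]
    refine (hφc.tendsto _).comp (tendsto_pi_nhds.mpr fun q => ?_)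
    have h1 := (hR q.1.1 q.1.2).log (by rw [hRp _ _ q.2]; exact (Real.exp_pos _).ne')
    rw [hRp _ _ q.2, Real.log_exp] at h1
    refine h1.congr' ?_
    filter_upwards [hev, hRv q.1.1 q.1.2] with v hv hRv
    rw [hRv, Real.log_exp]
    intro j hj
    refine (mem_faceOf_vanishingSum_iff hθ q.1.2.2).mp q.2 j ?_
    by_contra h
    exact hj (hv.1 j h)
  -- convergence of the absolute values of the polynomial coordinates
  have hnorm : ∀ j, Filter.Tendsto (fun v => ‖(chartPoint (t v) (z v)).1 j‖) F (𝓝 ‖p.1 j‖) := by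
    intro j
    by_cases hj : p.1 j = 0
    · obtain ⟨i, a, ha, hneg, hother⟩ := exists_coordinate_of_vanishing hA hθ hcone hj
      set m : ℝ := -pairing (a - c.θ i) (c.ξ (Sum.inl j)) with hm
      have hmpos : 0 < m := by linarith
      -- the contribution of the non-vanishing rays to the logarithm of the coordinate `a`
      let e : (Fin c.l ⊕ Fin (n - c.l) → ℂ) → ℝ := fun z =>
        ∑ k, if (∀ j, k = Sum.inl j → p.1 j ≠ 0) then
          (z k).re * pairing (a - c.θ i) (c.ξ k) else 0
      have he : Filter.Tendsto (fun v => e (z v)) F (𝓝 (e z₀)) := by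
        refine tendsto_finsetSum _ fun k _ => ?_
        by_cases hk : ∀ j, k = Sum.inl j → p.1 j ≠ 0
        · simp only [if_pos hk]
          exact (hcoord k hk).mul_const _
        · simp only [if_neg hk]
          exact tendsto_const_nhds
      have hnot : a ∉ faceOf (A i) (c.vanishingSum p) := by
        rw [mem_faceOf_vanishingSum_iff hθ ha]
        exact fun h => hneg.ne (h j hj)
      have hB : Filter.Tendsto
          (fun v => (normRatio hθ v i ⟨a, ha⟩ * Real.exp (-e (z v))) ^ (1 / m)) F (𝓝 0) := by
        have h1 := (hR i ⟨a, ha⟩).mul ((Real.continuous_exp.tendsto _).comp he.neg)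
        rw [hRp0 i ⟨a, ha⟩ hnot, zero_mul] at h1
        have h2 := h1.rpow_const (p := 1 / m) (Or.inr (by positivity))
        rwa [Real.zero_rpow (by positivity)] at h2
      rw [hj, norm_zero]
      refine tendsto_of_tendsto_of_tendsto_of_le_of_le' tendsto_const_nhds hB
        (Filter.Eventually.of_forall fun v => norm_nonneg _) ?_
      filter_upwards [hev, hRv i ⟨a, ha⟩] with v hv hRv
      by_cases ht : t v j = 0
      · have hR' := hRv fun k hk => hother k (by rintro rfl; exact hk ht)
          (by by_contra h; exact hk (hv.1 k h))
        have hsum : ∑ k, (z v k).re * pairing (a - c.θ i) (c.ξ k) =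
            -m * (z v (Sum.inl j)).re + e (z v) := by
          have h1 : ∀ k, (z v k).re * pairing (a - c.θ i) (c.ξ k) =
              (if k = Sum.inl j then -m * (z v (Sum.inl j)).re else 0) +
              if (∀ j, k = Sum.inl j → p.1 j ≠ 0) then
                (z v k).re * pairing (a - c.θ i) (c.ξ k) else 0 := by
            intro k
            by_cases hkj : k = Sum.inl j
            · subst hkj
              rw [if_pos rfl, if_neg fun h => h j rfl hj, hm]
              ring
            · rw [if_neg hkj, zero_add]
              split_ifs with hk
              · rfl
              · push Not at hk
                obtain ⟨k', rfl, hk'⟩ := hk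
                rw [hother k' (fun h => hkj (h ▸ rfl)) hk', mul_zero]
          rw [Finset.sum_congr rfl fun k _ => h1 k, Finset.sum_add_distrib,
            Finset.sum_ite_eq' , if_pos (Finset.mem_univ _)]
        rw [hR', hsum, ← Real.exp_add, ← Real.exp_mul]
        simp only [chartPoint, if_pos ht, Complex.norm_exp, Complex.neg_re]
        refine Real.exp_le_exp.mpr (le_of_eq ?_)
        field_simp
        ring
      · simp only [chartPoint, if_neg ht, norm_zero]
        exact Real.rpow_nonneg (mul_nonneg (div_nonneg (norm_nonneg _) (norm_nonneg _))
          (Real.exp_pos _).le) _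
    · have h1 := hcoord (Sum.inl j) fun j' h => by
        obtain rfl := Sum.inl_injective h
        exact hj
      have h2 := (Real.continuous_exp.tendsto _).comp h1.neg
      have h3 : Real.exp (-(z₀ (Sum.inl j)).re) = ‖p.1 j‖ := by
        simp [z₀, Complex.log_re, Real.exp_log (norm_pos_iff.mpr hj)]
      rw [h3] at h2
      refine h2.congr' ?_
      filter_upwards [hev] with v hv
      simp [chartPoint, hv.1 j hj, Complex.norm_exp]
  have hre : ∀ j, Filter.Tendsto (fun v => ((chartPoint (t v) (z v)).2 j).re) F
      (𝓝 (p.2 j).re) := by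
    intro j
    have h1 := (hcoord (Sum.inr j) fun j' h => by simp at h).neg
    simpa [z₀, chartPoint] using h1
  have hbound := (Real.continuous_exp.tendsto _).comp
    (((tendsto_pi_nhds.mpr hre).norm.const_mul (-Φ)).sub_const Ψ)
  have hdom : ∀ᶠ v in F, chartPoint (t v) (z v) ∈ c.domain Φ Ψ ε := by
    refine Filter.Eventually.and
      (Filter.eventually_all.mpr fun j => (hnorm j).eventually_lt hbound (hp.1 j))
      (Filter.eventually_all.mpr fun j => ?_)
    exact ((hre j).eventually_const_lt (hp.2 j).1).and ((hre j).eventually_lt_const (hp.2 j).2)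
  filter_upwards [hev, hdom] with v h1 h2 using ⟨_, h2, h1.2⟩

end Parameterization

/-! ### Mixed volume and the finite family of parameterizations -/

section Family

variable {n : ℕ} {A : Fin n → Finset (Fin n → ℤ)}

/-- If all `A i` lie in parallel hyperplanes, then so do all Minkowski sums of their convex hulls,
and the mixed volume vanishes. -/
theorem isNondegenerate_of_mixedVolume_ne_zero (h : mixedVolume A ≠ 0) : IsNondegenerate A := by
  intro x hx
  by_contra hx0
  apply h
  let f : (Fin n → ℝ) →ₗ[ℝ] ℝ := ∑ k, x k • LinearMap.proj k
  have hf : ∀ y, f y = ∑ k, y k * x k := fun y => by simp [f, mul_comm]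
  have hpoly : ∀ i, ∃ r : ℝ, polytope (A i) ⊆ {y | f y = r} := by
    intro i
    rcases (A i).eq_empty_or_nonempty with h0 | ⟨b, hb⟩
    · exact ⟨0, by simp [polytope, h0]⟩
    · refine ⟨pairing b x, convexHull_min ?_ (convex_hyperplane f.isLinear _)⟩
      rintro _ ⟨a, ha, rfl⟩
      change f _ = _
      rw [hf, ← hx i a ha b hb, pairing]
  choose r hr using hpoly
  have hsum : ∀ S : Finset (Fin n), ∑ i ∈ S, polytope (A i) ⊆ {y | f y = ∑ i ∈ S, r i} := by
    intro S y hy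
    obtain ⟨g, hg, rfl⟩ := (Set.mem_finsetSum _ _ _).mp hy
    change f _ = _
    rw [map_sum]
    exact Finset.sum_congr rfl fun i hi => hr i (hg hi)
  have hvol : ∀ t : ℝ, MeasureTheory.volume {y | f y = t} = 0 := by
    intro t
    rcases Set.eq_empty_or_nonempty {y | f y = t} with h0 | ⟨y₀, hy₀⟩
    · rw [h0, MeasureTheory.measure_empty]
    have hE : {y | f y = t} = (AffineSubspace.mk' y₀ (LinearMap.ker f) : Set (Fin n → ℝ)) := by
      ext y
      rw [SetLike.mem_coe, AffineSubspace.mem_mk', vsub_eq_sub, LinearMap.mem_ker, map_sub,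
        sub_eq_zero, show f y₀ = t from hy₀]
      rfl
    rw [hE]
    refine MeasureTheory.Measure.addHaar_affineSubspace _ _ fun htop => hx0 ?_
    have hker : LinearMap.ker f = ⊤ := by
      rw [← AffineSubspace.direction_mk' y₀ (LinearMap.ker f), htop, AffineSubspace.direction_top]
    have hfx : f x = 0 := LinearMap.mem_ker.mp (hker ▸ Submodule.mem_top)
    rw [hf, Finset.sum_eq_zero_iff_of_nonneg fun k _ => mul_self_nonneg _] at hfx
    exact funext fun k => mul_self_eq_zero.mp (hfx k (Finset.mem_univ k))
  rw [mixedVolume, Finset.sum_eq_zero, mul_zero]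
  intro S _
  rw [MeasureTheory.measure_mono_null (hsum S) (hvol _), ENNReal.toReal_zero, mul_zero]

/-- Only finitely many parameterizations have their shifts in the `A i`, since the fan has finitely
many rays. -/
theorem finite_setOf_parameterization (hA : ∀ i, (A i).Nonempty) :
    {c : Parameterization A | ∀ i, c.θ i ∈ A i}.Finite := by
  have : Finite {ρ | IsMinimalRayGenerator A ρ} := finite_setOf_isMinimalRayGenerator hA
  let f : {c : Parameterization A | ∀ i, c.θ i ∈ A i} →
      Σ l : Fin (n + 1), (Fin l ⊕ Fin (n - l) → {ρ | IsMinimalRayGenerator A ρ}) × (∀ i, A i) :=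
    fun c => ⟨⟨c.1.l, Nat.lt_succ_of_le c.1.l_le⟩, fun j => ⟨c.1.ξ j, c.1.minimal_ray j⟩,
      fun i => ⟨c.1.θ i, c.2 i⟩⟩
  refine Set.finite_coe_iff.mp (Finite.of_injective f ?_)
  rintro ⟨⟨l, hl, ξ, θ, _⟩, hc⟩ ⟨⟨l', hl', ξ', θ', _⟩, hc'⟩ h
  simp only [f, Sigma.mk.injEq, Fin.mk.injEq] at h
  obtain ⟨rfl, h⟩ := h
  simp only [heq_eq_eq, Prod.mk.injEq, funext_iff, Subtype.mk.injEq] at h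
  obtain ⟨h1, h2⟩ := h
  obtain rfl : ξ = ξ' := funext fun j => funext (h1 j)
  obtain rfl : θ = θ' := funext fun i => funext (h2 i)
  rfl

end Family

end ToricChart

theorem mainTheorem2 (n : ℕ) (A : Fin n → Finset (Fin n → ℤ))
    (hA : ToricChart.mixedVolume A ≠ 0) :
    ∃ (N : ℕ) (c : Fin N → ToricChart.Parameterization A),
      ∀ Φ Ψ ε : ℝ, 1 < Φ → 0 < Ψ → 0 < ε →
        (∀ k, IsOpen ((c k).domain Φ Ψ ε)) ∧
        (⋃ k, (c k).toFun '' (c k).domain Φ Ψ ε) = ToricChart.toricVariety A ∧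
        (∀ k, ∀ p ∈ (c k).domain Φ Ψ ε,
          ToricChart.IsFanCone A ((c k).vanishingCone p) →
            (c k).toFun '' (c k).domain Φ Ψ ε ∈
              𝓝[ToricChart.toricVariety A] ((c k).toFun p)) := by
  by_cases hne : ∀ i, (A i).Nonempty
  · have hnd := ToricChart.isNondegenerate_of_mixedVolume_ne_zero hA
    have : Finite {c : ToricChart.Parameterization A | ∀ i, c.θ i ∈ A i} :=
      ToricChart.finite_setOf_parameterization hne
    obtain ⟨N, ⟨e⟩⟩ := Finite.exists_equiv_fin
      {c : ToricChart.Parameterization A | ∀ i, c.θ i ∈ A i}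
    refine ⟨N, fun k => (e.symm k).1, fun Φ Ψ ε hΦ hΨ hε =>
      ⟨fun k => ToricChart.Parameterization.isOpen_domain _ _ _ _, ?_, fun k p hp hfan =>
        ToricChart.Parameterization.image_domain_mem_nhdsWithin hne (e.symm k).2 hp hfan⟩⟩
    refine subset_antisymm (Set.iUnion_subset fun k => ?_) fun v hv => ?_
    · rintro _ ⟨p, -, rfl⟩
      exact ToricChart.Parameterization.toFun_mem_toricVariety _ p
    · obtain ⟨c, hc, p, hp, rfl⟩ :=
        ToricChart.exists_parameterization_of_mem_toricVariety hne hnd hv hΦ hΨ hε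
      refine Set.mem_iUnion.mpr ⟨e ⟨c, hc⟩, ?_⟩
      have key : ∀ d, d = c → c.toFun p ∈ d.toFun '' d.domain Φ Ψ ε := by
        rintro d rfl
        exact ⟨p, hp, rfl⟩
      exact key _ (congrArg Subtype.val (e.symm_apply_apply _))
  · -- the projective space of the zero vector space is empty
    push Not at hne
    obtain ⟨i, hi⟩ := hne
    refine ⟨0, Fin.elim0, fun Φ Ψ ε _ _ _ => ⟨fun k => k.elim0, ?_, fun k => k.elim0⟩⟩
    have : IsEmpty (A i) := by rw [hi]; infer_instance
    refine (Set.iUnion_of_empty _).trans (Set.eq_empty_of_forall_notMem fun v _ => ?_).symm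
    exact (v i).rep_nonzero (Subsingleton.elim _ _)
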